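/- Setting. Let $D\ge 1$ be an integer and $\Lambda$ an arbitrary index set. For each $\lambda\in\Lambda$ let $M_\lambda\ge 1$ be an integer, with $\sup_\lambda M_\lambda<\infty$, and let $T_1^\lambda,\dots,T_{M_\lambda}^\lambda\colon\mathbb R^D\to\mathbb R^D$ be non-singular linear maps. Let $\sim$ be an equivalence relation on $\widehat\Lambda=\{(\lambda,i)\mid \lambda\in\Lambda,\ 1\le i\le M_\lambda\}$ with a finite number $\mathcal A$ of equivalence classes and such that $(\lambda,i)\sim(\lambda,j)$ only if $i=j$. A parameter $\mathbf a\in(\mathbb R^D)^{\mathcal A}=\mathbb R^{D\mathcal A}$ assigns to each equivalence class a vector in $\mathbb R^D$; writing $a_i^\lambda$ for the vector assigned to the class of $(\lambda,i)$, put $f_i^\lambda(x)=T_i^\lambda(x)+a_i^\lambda$. A code tree $\omega$ assigns an element of $\Lambda$ to each finite word of positive integers. Let $\Sigma^\omega_*$ be the set of finite words $i_1\cdots i_n$ ($n\ge0$) with $i_{k+1}\le M_{\omega(i_1\cdots i_k)}$ for all $0\le k<n$, and $\Sigma^\omega$ the set of infinite sequences all of whose initial words are in $\Sigma_*^\omega$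 (only the values of $\omega$ on $\Sigma^\omega_*$ matter). For $w=i_1\cdots i_n\in\Sigma_*^\omega$ let $$T_w^\omega=T_{i_1}^{\omega(\emptyset)}T_{i_2}^{\omega(i_1)}\cdots T_{i_n}^{\omega(i_1\cdots i_{n-1})},\qquad f_w^\omega=f_{i_1}^{\omega(\emptyset)}\circ f_{i_2}^{\omega(i_1)}\circ\cdots\circ f_{i_n}^{\omega(i_1\cdots i_{n-1})},$$ let $|w|=n$, and let $[w]$ be the set of sequences in $\Sigma^\omega$ with initial word $w$. The code tree fractal is $$A^\omega_{\mathbf a}=\Big\{\lim_{k\to\infty}f^\omega_{i_1\cdots i_k}(0)\ \Big|\ i_1i_2\cdots\in\Sigma^\omega\Big\}.$$ For a linear map $T$ of $\mathbb R^D$ with singular values $\sigma_1\ge\dots\ge\sigma_D$ and for $\alpha\ge0$ let $$\Phi^\alpha(T)=\sigma_1\cdots\sigma_{m-1}\sigma_m^{\alpha-m+1}\ \text{ if } \alpha<D,\ m-1\le\alpha<m,\ m\in\mathbb N;\qquad \Phi^\alpha(T)=\sigma_1\cdots\sigma_{D-1}\sigma_D^{\alpha-D+1}\ \text{ if }\alpha\ge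 D.$$ For $E\subset\Sigma^\omega$ let $M^\alpha(E)=\lim_{j\to\infty}M^\alpha_j(E)$, where $$M_j^\alpha(E)=\inf\Big\{\sum_{w\in J}\Phi^\alpha(T_w^\omega)\ \Big|\ J\subset\Sigma_*^\omega,\ E\subset\bigcup_{w\in J}[w],\ |w|\ge j\text{ for all }w\in J\Big\},$$ and let $d^\omega=\inf\{\alpha\ge0\mid M^\alpha(\Sigma^\omega)=0\}$ be the affinity dimension. Theorem. Assume that there is $\overline\sigma<\tfrac12$ such that all singular values of all the maps $T_i^\lambda$ ($\lambda\in\Lambda$, $1\le i\le M_\lambda$) are at most $\overline\sigma$. Then for every code tree $\omega$, $$\dim_H(A^\omega_{\mathbf a})=\min\{D,d^\omega\}\qquad\text{for Lebesgue-almost every }\mathbf a\in\mathbb R^{D\mathcal A}.$$ -/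

import Mathlib

open MeasureTheory Filter Topology
open scoped NNReal ENNReal

/-- A family `(F^l)` (`l` in the index set `L`) of affine iterated function systems on `ℝ^D`,
with the translation vectors left as free parameters. The system `F^l` has `card l` maps
`x ↦ lin l i x + a`, numbered by `i = 0, …, card l - 1`. The relation `rel` on the pairs `(l, i)`
says which translation vectors are identified with one another. -/
structure AffineFamily (D : ℕ) (L : Type*) where
  /-- the number of maps of each system -/
  card : L → ℕ
  card_pos : ∀ l, 0 < card l
  card_bdd : BddAbove (Set.range card)
  /-- the linear parts -/
  lin : (l : L) → Fin (card l) → (EuclideanSpace ℝ (Fin D) →ₗ[ℝ] EuclideanSpace ℝ (Fin D))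
  lin_nonsingular : ∀ l i, LinearMap.det (lin l i) ≠ 0
  /-- the identification of translation vectors -/
  rel : Setoid (Σ l : L, Fin (card l))
  /-- there are only finitely many equivalence classes -/
  rel_finite : Finite (Quotient rel)
  /-- inside one system different translation vectors are never identified -/
  rel_iff : ∀ l (i j : Fin (card l)), rel ⟨l, i⟩ ⟨l, j⟩ ↔ i = j

/-- The singular value function `Φ^α(T)`, where `σ 0 ≥ σ 1 ≥ … ≥ σ (D - 1)` are the singular
values of `T` (numbered from `0`): for `α < D` it is `σ 0 ⋯ σ (m - 1) * σ m ^ (α - m)` with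
`m = ⌊α⌋`, and for `α ≥ D` it is `σ 0 ⋯ σ (D - 2) * σ (D - 1) ^ (α - D + 1)`. -/
noncomputable def singularValueFunction {D : ℕ} (α : ℝ≥0)
    (T : EuclideanSpace ℝ (Fin D) →ₗ[ℝ] EuclideanSpace ℝ (Fin D)) : ℝ :=
  if (α : ℝ) < D then
    (∏ i ∈ Finset.range ⌊α⌋₊, T.singularValues i) *
      T.singularValues ⌊α⌋₊ ^ ((α : ℝ) - ⌊α⌋₊)
  else
    (∏ i ∈ Finset.range (D - 1), T.singularValues i) *
      T.singularValues (D - 1) ^ ((α : ℝ) - D + 1)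

/-- The initial word of length `k` of an infinite sequence. -/
def initialWord (x : ℕ → ℕ) (k : ℕ) : List ℕ := (List.range k).map x

namespace AffineFamily

variable {D : ℕ} {L : Type*} (F : AffineFamily D L)

/-- The set of equivalence classes of pairs `(l, i)`. Its elements label the independent
translation vectors. -/
def Classes : Type _ := Quotient F.rel

noncomputable instance : Fintype F.Classes :=
  haveI : Finite F.Classes := F.rel_finite
  Fintype.ofFinite F.Classes

/-- The linear part of the map number `i` of the system `F^l`. The value for `i ≥ card l` is
irrelevant. -/
noncomputable def linPart (l : L) (i : ℕ) :
    EuclideanSpace ℝ (Fin D) →ₗ[ℝ] EuclideanSpace ℝ (Fin D) :=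
  if h : i < F.card l then F.lin l ⟨i, h⟩ else LinearMap.id

/-- The translation vector of the map number `i` of the system `F^l`, for the parameter `a`, which
assigns a vector to every equivalence class. The value for `i ≥ card l` is irrelevant. -/
noncomputable def translation (a : F.Classes → EuclideanSpace ℝ (Fin D)) (l : L) (i : ℕ) :
    EuclideanSpace ℝ (Fin D) :=
  if h : i < F.card l then a (Quotient.mk F.rel ⟨l, ⟨i, h⟩⟩) else 0

/-- The affine map number `i` of the system `F^l`, for the translation parameter `a`. -/
noncomputable def affMap (a : F.Classes → EuclideanSpace ℝ (Fin D)) (l : L) (i : ℕ) :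
    EuclideanSpace ℝ (Fin D) → EuclideanSpace ℝ (Fin D) :=
  fun x => F.linPart l i x + F.translation a l i

/-- The set `Σ_*^ω` of finite words `i₁ ⋯ i_n` that are paths in the code tree `ω`, i.e. such that
each letter `i_{k+1}` is the number of a map of the system `ω (i₁ ⋯ i_k)`. A code tree is given
by a labelling of all finite words; only the labels of the words in `Σ_*^ω` matter. -/
def words (ω : List ℕ → L) : Set (List ℕ) :=
  {w | ∀ (k : ℕ) (hk : k < w.length), w[k] < F.card (ω (w.take k))}

theorem nil_mem_words (ω : List ℕ → L) : [] ∈ F.words ω := by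
  intro k hk
  simp at hk

theorem snoc_mem_words_iff (ω : List ℕ → L) (w : List ℕ) (i : ℕ) :
    w ++ [i] ∈ F.words ω ↔ w ∈ F.words ω ∧ i < F.card (ω w) := by
  constructor
  · intro h
    refine ⟨fun k hk => ?_, ?_⟩
    · have := h k (by simp; omega)
      rwa [List.getElem_append_left hk, List.take_append_of_le_length hk.le] at this
    · have := h w.length (by simp)
      simpa using this
  · rintro ⟨h, hi⟩ k hk
    rcases Nat.lt_or_ge k w.length with hk' | hk'
    · rw [List.getElem_append_left hk', List.take_append_of_le_length hk'.le]
      exact h k hk'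
    · have hkw : k = w.length := by
        simp at hk
        omega
      subst hkw
      simpa using hi

/-- The set `Σ^ω` of infinite paths of the code tree `ω`. -/
def paths (ω : List ℕ → L) : Set (ℕ → ℕ) :=
  {x | ∀ n, initialWord x n ∈ F.words ω}

/-- The cylinder `[w]`: the infinite paths with initial word `w`. -/
def cylinder (ω : List ℕ → L) (w : List ℕ) : Set (ℕ → ℕ) :=
  {x ∈ F.paths ω | initialWord x w.length = w}

/-- `T^ω_w`, the composition of the linear parts along the word `w`. After the first letter `i`
one continues in the code tree `v ↦ ω (i v)`. -/
noncomputable def wordLin (ω : List ℕ → L) :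
    List ℕ → (EuclideanSpace ℝ (Fin D) →ₗ[ℝ] EuclideanSpace ℝ (Fin D))
  | [] => LinearMap.id
  | i :: w => F.linPart (ω []) i ∘ₗ wordLin (fun v => ω (i :: v)) w

/-- `f^ω_w`, the composition of the affine maps along the word `w`, for the translation
parameter `a`. -/
noncomputable def wordMap (a : F.Classes → EuclideanSpace ℝ (Fin D)) (ω : List ℕ → L) :
    List ℕ → EuclideanSpace ℝ (Fin D) → EuclideanSpace ℝ (Fin D)
  | [] => id
  | i :: w => F.affMap a (ω []) i ∘ wordMap a (fun v => ω (i :: v)) w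

theorem wordLin_snoc (ω : List ℕ → L) (w : List ℕ) (i : ℕ) :
    F.wordLin ω (w ++ [i]) = F.wordLin ω w ∘ₗ F.linPart (ω w) i := by
  induction w generalizing ω with
  | nil => rfl
  | cons j w ih =>
    simp only [List.cons_append, wordLin, ih]
    rfl

theorem wordMap_snoc (a : F.Classes → EuclideanSpace ℝ (Fin D)) (ω : List ℕ → L) (w : List ℕ)
    (i : ℕ) : F.wordMap a ω (w ++ [i]) = F.wordMap a ω w ∘ F.affMap a (ω w) i := by
  induction w generalizing ω with
  | nil => rfl
  | cons j w ih =>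
    simp only [List.cons_append, wordMap, ih]
    rfl

/-- The code tree fractal `A^ω_a`: the set of the limits of `f^ω_{x_1 ⋯ x_k}(0)` as `k → ∞`, where
`x` runs through the infinite paths of `ω`. -/
def attractor (a : F.Classes → EuclideanSpace ℝ (Fin D)) (ω : List ℕ → L) :
    Set (EuclideanSpace ℝ (Fin D)) :=
  {z | ∃ x ∈ F.paths ω,
    Tendsto (fun k => F.wordMap a ω (initialWord x k) 0) atTop (𝓝 z)}

/-- `M_j^α(E)`: the infimum of `∑_{w ∈ J} Φ^α(T^ω_w)` over all sets `J` of words of `Σ_*^ω` of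
length at least `j` whose cylinders cover `E`. -/
noncomputable def preNaturalMeasure (ω : List ℕ → L) (α : ℝ≥0) (j : ℕ) (E : Set (ℕ → ℕ)) :
    ℝ≥0∞ :=
  ⨅ (J : Set (List ℕ)) (_ : J ⊆ F.words ω) (_ : ∀ w ∈ J, j ≤ w.length)
    (_ : E ⊆ ⋃ w ∈ J, F.cylinder ω w),
    ∑' w : J, ENNReal.ofReal (singularValueFunction α (F.wordLin ω w))

/-- `M_j^α(E)` increases with `j`, so that its limit is its supremum. -/
theorem preNaturalMeasure_mono (ω : List ℕ → L) (α : ℝ≥0) (E : Set (ℕ → ℕ)) :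
    Monotone fun j => F.preNaturalMeasure ω α j E := by
  intro j k hjk
  refine le_iInf fun J => le_iInf fun h1 => le_iInf fun h2 => le_iInf fun h3 => ?_
  exact iInf_le_of_le J (iInf_le_of_le h1
    (iInf_le_of_le (fun w hw => hjk.trans (h2 w hw)) (iInf_le_of_le h3 le_rfl)))

/-- The `α`-dimensional natural measure `M^α(E) = lim_{j → ∞} M_j^α(E)`. -/
noncomputable def naturalMeasure (ω : List ℕ → L) (α : ℝ≥0) (E : Set (ℕ → ℕ)) : ℝ≥0∞ :=
  ⨆ j, F.preNaturalMeasure ω α j E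

theorem tendsto_preNaturalMeasure (ω : List ℕ → L) (α : ℝ≥0) (E : Set (ℕ → ℕ)) :
    Tendsto (fun j => F.preNaturalMeasure ω α j E) atTop (𝓝 (F.naturalMeasure ω α E)) :=
  tendsto_atTop_iSup (F.preNaturalMeasure_mono ω α E)

/-- The affinity dimension `d^ω = inf {α ≥ 0 | M^α(Σ^ω) = 0}`. -/
noncomputable def affinityDim (ω : List ℕ → L) : ℝ≥0∞ :=
  ⨅ (α : ℝ≥0) (_ : F.naturalMeasure ω α (F.paths ω) = 0), (α : ℝ≥0∞)

end AffineFamily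

/-!
# The dimension of code tree fractals for almost every translation parameter

The method is that of Falconer, with Solomyak's improvement of the norm bound from `1/3` to `1/2`.

*Upper bound, for every parameter.* If `M^s(Σ^ω) = 0` with `s < D` and `m = ⌊s⌋`, one takes a
covering of `Σ^ω` by cylinders with a small sum of `Φ^s(T_w)`. The piece of the attractor that
belongs to `[w]` lies in the image of a fixed ball under an affine map with linear part `T_w`,
that is, in a box with sides comparable to the singular values of `T_w`. Cutting this box into cubes
whose side is comparable to the `m`-th singular value (numbered from `0`) gives a covering whose sum
of `s`-th powers of diameters is at most a constant times `Φ^s(T_w)`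
(`exists_cover_image_closedBall`, `prod_boxCount_mul_rpow_le`). So the Hausdorff measure `μH[s]`
of the attractor vanishes.

*Lower bound, for almost every parameter.* Let `0 < s < min D d^ω` and `0 < θ < 1`. As
`M^s(Σ^ω) > 0`, the code tree carries a Frostman measure, a probability measure `μ` with
`μ[w] ≤ C Φ^s(T_w)` (`AffineFamily.exists_frostman_measure`). The coding map `π` is linear in
the parameter `a`. If two paths `x`, `y` have exactly the word `w` in common, then
`π(x) - π(y) = T_w (π(x') - π(y'))`, where the tails `x'`, `y'` differ in the first letter. The two
first letters belong to different translation vectors, and since `σ < 1/2`, the map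
`a ↦ π(x') - π(y')` is uniformly expanding in one of them
(`AffineFamily.ContractsBy.exists_le_norm_coding_sub_single`). Integrating over this vector gives
`∫ ‖π(x) - π(y)‖^{-θ s} da ≤ C' ∫_{‖z‖ ≤ R} ‖T_w z‖^{-θ s} dz ≤ C'' Φ^s(T_w)^{-θ}`
(`exists_setLIntegral_comp_clm_le`, `exists_lintegral_enorm_map_rpow_neg_le`). Summing over the words
`w`, the average over `a` of the `θ s`-energy of the image of `μ` is at most a constant times
`∑ n, σ^{n s (1 - θ)} < ∞`. So the energy is finite for almost every `a`, and the dimension is at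
least `θ s`.
-/

open scoped RealInnerProductSpace

/-! ### Singular value decomposition and the singular value function -/

section SingularValues

variable {D : ℕ} {T : EuclideanSpace ℝ (Fin D) →ₗ[ℝ] EuclideanSpace ℝ (Fin D)}

theorem singularValues_pos_of_injective (hT : Function.Injective T) (i : Fin D) :
    0 < T.singularValues i :=
  T.injective_iff_forall_lt_finrank_singularValues_pos.1 hT i (by simp)

/-- Singular value decomposition of an injective map. -/
theorem exists_singularValueDecomposition (hT : Function.Injective T) :
    ∃ v u : OrthonormalBasis (Fin D) ℝ (EuclideanSpace ℝ (Fin D)),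
      ∀ i, T (v i) = T.singularValues i • u i := by
  have hn : Module.finrank ℝ (EuclideanSpace ℝ (Fin D)) = D := by simp
  set v := T.isSymmetric_adjoint_comp_self.eigenvectorBasis hn with hv
  have hpos := singularValues_pos_of_injective hT
  have hin : ∀ i j, ⟪T (v i), T (v j)⟫ = if i = j then T.singularValues i ^ 2 else 0 := by
    intro i j
    have h1 : ⟪T (v i), T (v j)⟫ = ⟪v i, (LinearMap.adjoint T ∘ₗ T) (v j)⟫ := by
      rw [LinearMap.comp_apply, LinearMap.adjoint_inner_right]
    rw [h1, hv, LinearMap.IsSymmetric.apply_eigenvectorBasis, ← T.sq_singularValues_fin hn,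
      inner_smul_right, orthonormal_iff_ite.1 (OrthonormalBasis.orthonormal _)]
    split_ifs with h <;> simp [h]
  have ho : Orthonormal ℝ fun i : Fin D => (T.singularValues i)⁻¹ • T (v i) := by
    rw [orthonormal_iff_ite]
    intro i j
    rw [inner_smul_left, inner_smul_right, hin]
    split_ifs with h
    · subst h
      have := (hpos i).ne'
      simp
      field_simp
    · simp
  obtain ⟨u, hu⟩ := Orthonormal.exists_orthonormalBasis_extension_of_card_eq (𝕜 := ℝ)
    (ι := Fin D) (v := fun i : Fin D => (T.singularValues i)⁻¹ • T (v i)) (s := Set.univ) (by simp)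
    (ho.comp _ Subtype.val_injective)
  refine ⟨v, u, fun i => ?_⟩
  rw [hu i (Set.mem_univ _), smul_inv_smul₀ (hpos i).ne']

theorem inner_eq_singularValues_mul_inner
    {v u : OrthonormalBasis (Fin D) ℝ (EuclideanSpace ℝ (Fin D))}
    (h : ∀ i, T (v i) = T.singularValues i • u i) (i : Fin D) (z : EuclideanSpace ℝ (Fin D)) :
    ⟪u i, T z⟫ = T.singularValues i * ⟪v i, z⟫ := by
  conv_lhs => rw [← v.sum_repr z]
  simp only [map_sum, map_smul, h, inner_sum, inner_smul_right]
  rw [Finset.sum_eq_single i]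
  · simp [OrthonormalBasis.repr_apply_apply, mul_comm]
  · intro j _ hj
    simp [orthonormal_iff_ite.1 u.orthonormal, hj.symm]
  · simp

theorem norm_map_le_of_singularValues_le (hT : Function.Injective T) {c : ℝ} (hc : 0 ≤ c)
    (h : ∀ k, T.singularValues k ≤ c) (z : EuclideanSpace ℝ (Fin D)) : ‖T z‖ ≤ c * ‖z‖ := by
  obtain ⟨v, u, hvu⟩ := exists_singularValueDecomposition hT
  refine le_of_sq_le_sq ?_ (by positivity)
  rw [mul_pow, ← u.sum_sq_norm_inner_right, ← v.sum_sq_norm_inner_right z, Finset.mul_sum]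
  refine Finset.sum_le_sum fun i _ => ?_
  rw [inner_eq_singularValues_mul_inner hvu, norm_mul, mul_pow]
  gcongr
  rw [Real.norm_of_nonneg (T.singularValues_nonneg _)]
  exact h i

theorem singularValues_le_of_norm_map_le (hT : Function.Injective T) {c : ℝ} (hc : 0 ≤ c)
    (h : ∀ z, ‖T z‖ ≤ c * ‖z‖) (k : ℕ) : T.singularValues k ≤ c := by
  rcases lt_or_ge k D with hk | hk
  · obtain ⟨v, u, hvu⟩ := exists_singularValueDecomposition hT
    have := h (v ⟨k, hk⟩)
    rw [hvu, norm_smul, Real.norm_of_nonneg (T.singularValues_nonneg _)] at this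
    simpa using this
  · rw [T.singularValues_of_finrank_le (by simpa using hk)]
    exact hc

/-- The exponents of the singular values in `Φ^s` for `s < D`, that is `1, …, 1, s - ⌊s⌋, 0, …`. -/
noncomputable def singularValueExponent (s : ℝ≥0) (i : ℕ) : ℝ :=
  if i < ⌊s⌋₊ then 1 else if i = ⌊s⌋₊ then (s : ℝ) - ⌊s⌋₊ else 0

theorem singularValueExponent_nonneg (s : ℝ≥0) (i : ℕ) : 0 ≤ singularValueExponent s i := by
  have : (⌊s⌋₊ : ℝ) ≤ s := by exact_mod_cast Nat.floor_le (zero_le : 0 ≤ s)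
  unfold singularValueExponent
  split_ifs <;> linarith

theorem singularValueExponent_le_one (s : ℝ≥0) (i : ℕ) : singularValueExponent s i ≤ 1 := by
  have : (s : ℝ) < ⌊s⌋₊ + 1 := by exact_mod_cast Nat.lt_floor_add_one s
  unfold singularValueExponent
  split_ifs <;> linarith

theorem floor_lt_of_coe_lt {s : ℝ≥0} (hs : (s : ℝ) < D) : ⌊s⌋₊ < D :=
  (Nat.floor_lt zero_le).2 (by exact_mod_cast hs)

/-- Splitting the index set `Fin D` according to `singularValueExponent`. -/
theorem prod_fin_ite_floor {M : Type*} [CommMonoid M] {m : ℕ} (hm : m < D) (f g : ℕ → M) :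
    ∏ i : Fin D, (if (i : ℕ) < m then f i else if (i : ℕ) = m then g i else 1) =
      (∏ i ∈ Finset.range m, f i) * g m := by
  rw [Fin.prod_univ_eq_prod_range
    (fun i => if i < m then f i else if i = m then g i else 1) D]
  obtain ⟨k, rfl⟩ : ∃ k, D = m + 1 + k := ⟨D - (m + 1), by omega⟩
  rw [Finset.prod_range_add, Finset.prod_range_succ]
  have h1 : ∏ x ∈ Finset.range m, (if x < m then f x else if x = m then g x else 1) =
      ∏ i ∈ Finset.range m, f i :=
    Finset.prod_congr rfl fun i hi => by simp [Finset.mem_range.1 hi]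
  have h2 : ∏ x ∈ Finset.range k, (if m + 1 + x < m then f (m + 1 + x) else
      if m + 1 + x = m then g (m + 1 + x) else 1) = 1 :=
    Finset.prod_eq_one fun i _ => by
      rw [if_neg (by omega), if_neg (by omega)]
  rw [h1, h2]
  simp

theorem sum_singularValueExponent {s : ℝ≥0} (hs : (s : ℝ) < D) :
    ∑ i : Fin D, singularValueExponent s i = s := by
  have := prod_fin_ite_floor (M := Multiplicative ℝ) (floor_lt_of_coe_lt hs)
    (fun _ => Multiplicative.ofAdd 1) (fun _ => Multiplicative.ofAdd ((s : ℝ) - ⌊s⌋₊))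
  have h2 : ∑ i : Fin D, singularValueExponent s i =
      Multiplicative.toAdd (∏ i : Fin D, Multiplicative.ofAdd (singularValueExponent s i)) := by
    simp
  rw [h2]
  unfold singularValueExponent
  simp only [apply_ite Multiplicative.ofAdd, ofAdd_zero]
  rw [this]
  simp

theorem singularValueFunction_eq_prod {s : ℝ≥0} (hs : (s : ℝ) < D) :
    singularValueFunction s T = ∏ i : Fin D, T.singularValues i ^ singularValueExponent s i := by
  rw [singularValueFunction, if_pos hs, ← prod_fin_ite_floor (floor_lt_of_coe_lt hs)
    (fun i => T.singularValues i) (fun i => T.singularValues i ^ ((s : ℝ) - ⌊s⌋₊))]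
  refine Finset.prod_congr rfl fun i _ => ?_
  unfold singularValueExponent
  split_ifs <;> simp

theorem singularValueFunction_pos (hT : Function.Injective T) {s : ℝ≥0} (hs : (s : ℝ) < D) :
    0 < singularValueFunction s T := by
  rw [singularValueFunction_eq_prod hs]
  exact Finset.prod_pos fun i _ => Real.rpow_pos_of_pos (singularValues_pos_of_injective hT i) _

theorem singularValueFunction_le_rpow (hT : Function.Injective T) {s : ℝ≥0} (hs : (s : ℝ) < D)
    {c : ℝ} (hc : 0 < c) (h : ∀ z, ‖T z‖ ≤ c * ‖z‖) :
    singularValueFunction s T ≤ c ^ (s : ℝ) := by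
  rw [singularValueFunction_eq_prod hs, ← sum_singularValueExponent hs, Real.rpow_sum_of_pos hc]
  exact Finset.prod_le_prod (fun i _ => Real.rpow_nonneg (T.singularValues_nonneg _) _)
    fun i _ => Real.rpow_le_rpow (T.singularValues_nonneg _)
      (singularValues_le_of_norm_map_le hT hc.le h _) (singularValueExponent_nonneg _ _)

end SingularValues

/-! ### Integrals of negative powers of the norm of a linear map -/

section Integrals

theorem lintegral_Icc_enorm_rpow_neg_lt_top {p : ℝ} (hp : p < 1) (R : ℝ) :
    ∫⁻ z in Set.Icc (-R) R, ‖z‖ₑ ^ (-p) < ∞ := by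
  have h0 : ∫⁻ z in Set.Icc 0 R, ‖z‖ₑ ^ (-p) < ∞ := by
    rcases lt_or_ge R 0 with hR | hR
    · simp [Set.Icc_eq_empty (not_le.2 hR)]
    have h1 := (intervalIntegral.intervalIntegrable_rpow' (a := 0) (b := R) (r := -p)
      (by linarith)).1
    rw [setLIntegral_congr Ioc_ae_eq_Icc.symm]
    refine lt_of_eq_of_lt (setLIntegral_congr_fun measurableSet_Ioc fun z hz => ?_) h1.2
    simp only []
    rw [Real.enorm_eq_ofReal hz.1.le, Real.enorm_eq_ofReal (Real.rpow_nonneg hz.1.le _),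
      ENNReal.ofReal_rpow_of_pos hz.1]
  have h1 : ∫⁻ z in Set.Icc (-R) 0, ‖z‖ₑ ^ (-p) = ∫⁻ z in Set.Icc 0 R, ‖z‖ₑ ^ (-p) := by
    have := (Measure.measurePreserving_neg (volume : Measure ℝ)).setLIntegral_comp_preimage_emb
      (MeasurableEquiv.neg ℝ).measurableEmbedding (fun z => ‖z‖ₑ ^ (-p)) (Set.Icc 0 R)
    rw [← this]
    simp
  calc ∫⁻ z in Set.Icc (-R) R, ‖z‖ₑ ^ (-p)
      ≤ ∫⁻ z in Set.Icc (-R) 0 ∪ Set.Icc 0 R, ‖z‖ₑ ^ (-p) :=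
        lintegral_mono_set fun z hz => by
          rcases le_total z 0 with h | h
          · exact Or.inl ⟨hz.1, h⟩
          · exact Or.inr ⟨h, hz.2⟩
    _ ≤ _ := lintegral_union_le _ _ _
    _ < ∞ := by rw [h1]; exact ENNReal.add_lt_top.2 ⟨h0, h0⟩

/-- Negative powers of the coordinates with exponents `> -1` are locally integrable. -/
theorem lintegral_pi_prod_enorm_rpow_neg_lt_top {ι : Type*} [Fintype ι] {p : ι → ℝ}
    (hp : ∀ i, p i < 1) (R : ℝ) :
    ∫⁻ z : ι → ℝ, ∏ i, (Set.Icc (-R) R).indicator (fun z => ‖z‖ₑ ^ (-p i)) (z i) < ∞ := by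
  have hm : ∀ i, Measurable fun z : ℝ => ‖z‖ₑ ^ (-p i) := fun i => by fun_prop
  have hI : ∀ i, Integrable (fun z => ((Set.Icc (-R) R).indicator (fun z => ‖z‖ₑ ^ (-p i)) z).toReal)
      (volume : Measure ℝ) := fun i => by
    refine integrable_toReal_of_lintegral_ne_top
      ((hm i).indicator measurableSet_Icc).aemeasurable ?_
    rw [lintegral_indicator measurableSet_Icc]
    exact (lintegral_Icc_enorm_rpow_neg_lt_top (hp i) R).ne
  have h2 := (Integrable.fintype_prod hI).2
  refine lt_of_le_of_lt (lintegral_mono_ae ?_) h2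
  have h0 : ∀ᵐ z : ι → ℝ, ∀ i, z i ≠ 0 := by
    rw [ae_all_iff]
    intro i
    exact (Measure.quasiMeasurePreserving_eval (fun _ : ι => (volume : Measure ℝ)) i).ae (p := fun z => z ≠ 0) (by
      simp [ae_iff])
  filter_upwards [h0] with z hz
  rw [← ENNReal.toReal_prod, Real.enorm_eq_ofReal ENNReal.toReal_nonneg, ENNReal.ofReal_toReal]
  refine ENNReal.prod_ne_top fun i _ => ?_
  rw [Set.indicator_apply]
  split_ifs
  · exact ENNReal.rpow_ne_top_of_ne_zero (by simpa using hz i) (by simp)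
  · simp

/-- The borderline exponents `1` in `Φ^s` would make the coordinate integrals diverge; the factor
`θ < 1` restores integrability, at the cost of the exponent `θ` of `Φ^s`. -/
theorem exists_lintegral_enorm_map_rpow_neg_le {D : ℕ} (hD : 0 < D) {s : ℝ≥0} (hs : (s : ℝ) < D)
    {θ : ℝ} (hθ0 : 0 ≤ θ) (hθ : θ < 1) (R : ℝ) :
    ∃ C : ℝ≥0∞, C ≠ ∞ ∧ ∀ T : EuclideanSpace ℝ (Fin D) →ₗ[ℝ] EuclideanSpace ℝ (Fin D),
      Function.Injective T →
      ∫⁻ z in Metric.closedBall 0 R, ‖T z‖ₑ ^ (-(θ * s)) ≤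
        C * ENNReal.ofReal (singularValueFunction s T) ^ (-θ) := by
  have : Nonempty (Fin D) := ⟨⟨0, hD⟩⟩
  set e : Fin D → ℝ := fun i => θ * singularValueExponent s i with he
  have he0 : ∀ i, 0 ≤ e i := fun i => mul_nonneg hθ0 (singularValueExponent_nonneg _ _)
  have he1 : ∀ i, e i < 1 := fun i =>
    lt_of_le_of_lt (mul_le_of_le_one_right hθ0 (singularValueExponent_le_one _ _)) hθ
  have hsum : ∑ i, e i = θ * s := by
    rw [he, ← Finset.mul_sum, sum_singularValueExponent hs]
  refine ⟨∫⁻ z : Fin D → ℝ, ∏ i, (Set.Icc (-R) R).indicator (fun z => ‖z‖ₑ ^ (-e i)) (z i),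
    (lintegral_pi_prod_enorm_rpow_neg_lt_top he1 R).ne, fun T hT => ?_⟩
  obtain ⟨v, u, hvu⟩ := exists_singularValueDecomposition hT
  set F : (Fin D → ℝ) → ℝ≥0∞ := fun z =>
    ∏ i, (Set.Icc (-R) R).indicator (fun z => ‖z‖ₑ ^ (-e i)) (z i) with hF
  have hFm : Measurable F := by
    refine Finset.measurable_prod _ fun i _ => ?_
    exact ((by fun_prop : Measurable fun z : ℝ => ‖z‖ₑ ^ (-e i)).indicator
      measurableSet_Icc).comp (measurable_pi_apply i)
  have hΦ : ENNReal.ofReal (singularValueFunction s T) ^ (-θ) =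
      ∏ i : Fin D, ENNReal.ofReal (T.singularValues i) ^ (-e i) := by
    rw [singularValueFunction_eq_prod hs, ENNReal.ofReal_prod_of_nonneg
      (fun i _ => Real.rpow_nonneg (T.singularValues_nonneg _) _),
      ← ENNReal.prod_rpow_of_ne_top (fun i _ => ENNReal.ofReal_ne_top)]
    refine Finset.prod_congr rfl fun i _ => ?_
    rw [← ENNReal.ofReal_rpow_of_pos (singularValues_pos_of_injective hT i), ← ENNReal.rpow_mul]
    congr 1
    simp [he, mul_comm]
  have hmp : MeasurePreserving (fun z => WithLp.ofLp (v.repr z)) volume volume :=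
    (PiLp.volume_preserving_ofLp (Fin D)).comp v.measurePreserving_repr
  -- in singular coordinates `‖T z‖ ≥ σ_i |z_i|` for each `i`; multiply these bounds with the
  -- weights `e i`, whose sum is `θ * s`
  have hle : ∀ z ∈ Metric.closedBall (0 : EuclideanSpace ℝ (Fin D)) R, z ≠ 0 →
      ‖T z‖ₑ ^ (-(θ * s)) ≤
        F (WithLp.ofLp (v.repr z)) * ENNReal.ofReal (singularValueFunction s T) ^ (-θ) := by
    intro z hz hz0
    have hTz : ‖T z‖ₑ ≠ 0 := by
      simpa using (map_ne_zero_iff T hT).2 hz0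
    rw [hΦ, hF, ← Finset.prod_mul_distrib, ← hsum, ← Finset.sum_neg_distrib]
    have hprod : ‖T z‖ₑ ^ (∑ i, -e i) = ∏ i, ‖T z‖ₑ ^ (-e i) := by
      induction (Finset.univ : Finset (Fin D)) using Finset.cons_induction with
      | empty => simp
      | cons a s ha ih => rw [Finset.sum_cons, Finset.prod_cons,
          ENNReal.rpow_add _ _ hTz (by simp), ih]
    rw [hprod]
    refine Finset.prod_le_prod' fun i _ => ?_
    have hzi : ⟪v i, z⟫ ∈ Set.Icc (-R) R := by
      rw [Set.mem_Icc, ← abs_le]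
      refine (abs_real_inner_le_norm _ _).trans ?_
      simpa using hz
    have hrepr : WithLp.ofLp (v.repr z) i = ⟪v i, z⟫ := v.repr_apply_apply z i
    rw [hrepr, Set.indicator_of_mem hzi, ← ENNReal.mul_rpow_of_ne_top (by simp) (by simp),
      ENNReal.rpow_neg, ENNReal.rpow_neg, ENNReal.inv_le_inv]
    refine ENNReal.rpow_le_rpow ?_ (he0 i)
    rw [mul_comm, ← Real.enorm_eq_ofReal (T.singularValues_nonneg _), ← enorm_mul,
      ← inner_eq_singularValues_mul_inner hvu]
    rw [enorm_le_iff_norm_le]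
    simpa using norm_inner_le_norm (𝕜 := ℝ) (u i) (T z)
  calc ∫⁻ z in Metric.closedBall 0 R, ‖T z‖ₑ ^ (-(θ * s))
      ≤ ∫⁻ z in Metric.closedBall 0 R,
        F (WithLp.ofLp (v.repr z)) * ENNReal.ofReal (singularValueFunction s T) ^ (-θ) := by
        refine setLIntegral_mono_ae' Metric.isClosed_closedBall.measurableSet ?_
        have h0 : ∀ᵐ z : EuclideanSpace ℝ (Fin D), z ≠ 0 := by simp [ae_iff]
        filter_upwards [h0] with z hz0 hz using hle z hz hz0
    _ ≤ ∫⁻ z, F (WithLp.ofLp (v.repr z)) * ENNReal.ofReal (singularValueFunction s T) ^ (-θ) :=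
        setLIntegral_le_lintegral _ _
    _ = (∫⁻ z, F z) * ENNReal.ofReal (singularValueFunction s T) ^ (-θ) := by
        have hm : Measurable fun z => F (WithLp.ofLp (v.repr z)) := hFm.comp hmp.measurable
        rw [lintegral_mul_const _ hm, hmp.lintegral_comp hFm]

end Integrals

/-! ### Integration along a linear map that is expanding in one coordinate -/

section ChangeOfVariables

variable {ι : Type*} [DecidableEq ι] {E : Type*} [NormedAddCommGroup E]
  [NormedSpace ℝ E]

/-- The linear endomorphism of `ι → E` which replaces the coordinate `q` of `a` by `Λ a`. -/
def replaceCoord (Λ : (ι → E) →L[ℝ] E) (q : ι) : (ι → E) →ₗ[ℝ] (ι → E) :=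
  LinearMap.pi fun p => if p = q then (Λ : (ι → E) →ₗ[ℝ] E) else LinearMap.proj p

theorem replaceCoord_apply_self (Λ : (ι → E) →L[ℝ] E) (q : ι) (a : ι → E) :
    replaceCoord Λ q a q = Λ a := by
  simp [replaceCoord]

theorem replaceCoord_apply_of_ne (Λ : (ι → E) →L[ℝ] E) {q p : ι} (hp : p ≠ q) (a : ι → E) :
    replaceCoord Λ q a p = a p := by
  simp [replaceCoord, hp]

variable [Fintype ι]

theorem norm_le_of_norm_replaceCoord_le {Λ : (ι → E) →L[ℝ] E} {q : ι} {c M : ℝ} (hc : 0 < c)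
    (hΛ : ∀ e, c * ‖e‖ ≤ ‖Λ (Pi.single q e)‖) (hM : ‖Λ‖ ≤ M) {a : ι → E} {r : ℝ}
    (ha : ‖replaceCoord Λ q a‖ ≤ r) : ‖a‖ ≤ max 1 ((1 + M) / c) * r := by
  have hr : 0 ≤ r := (norm_nonneg _).trans ha
  have hcoord := (pi_norm_le_iff_of_nonneg hr).1 ha
  have hM0 : 0 ≤ M := (norm_nonneg _).trans hM
  refine (pi_norm_le_iff_of_nonneg (by positivity)).2 fun p => ?_
  by_cases hp : p = q
  · subst hp
    -- split off the coordinate `p`: the remaining ones are bounded by `r`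
    set b : ι → E := a - Pi.single p (a p) with hb
    have hbn : ‖b‖ ≤ r := by
      refine (pi_norm_le_iff_of_nonneg hr).2 fun j => ?_
      by_cases hj : j = p
      · subst hj
        simpa [hb] using hr
      · have := hcoord j
        rw [replaceCoord_apply_of_ne Λ hj] at this
        simpa [hb, hj] using this
    have h1 : ‖Λ a‖ ≤ r := by
      have := hcoord p
      rwa [replaceCoord_apply_self] at this
    have h2 : ‖Λ b‖ ≤ M * r := (Λ.le_opNorm b).trans (by gcongr)
    have h3 : Λ (Pi.single p (a p)) = Λ a - Λ b := by
      rw [← map_sub, hb, sub_sub_cancel]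
    have h4 : c * ‖a p‖ ≤ r + M * r := by
      refine (hΛ (a p)).trans ?_
      rw [h3]
      exact (norm_sub_le _ _).trans (add_le_add h1 h2)
    calc ‖a p‖ ≤ (1 + M) / c * r := by
          rw [div_mul_eq_mul_div, le_div_iff₀ hc]
          linarith
      _ ≤ max 1 ((1 + M) / c) * r := by gcongr; exact le_max_right _ _
  · have := hcoord p
    rw [replaceCoord_apply_of_ne Λ hp] at this
    exact this.trans (le_mul_of_one_le_left hr (le_max_left _ _))

theorem det_replaceCoord_ne_zero {Λ : (ι → E) →L[ℝ] E} {q : ι} {c : ℝ} (hc : 0 < c)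
    (hΛ : ∀ e, c * ‖e‖ ≤ ‖Λ (Pi.single q e)‖) : LinearMap.det (replaceCoord Λ q) ≠ 0 := by
  intro h
  have hlt := LinearMap.bot_lt_ker_of_det_eq_zero h
  refine hlt.ne' (LinearMap.ker_eq_bot'.2 fun a ha => ?_)
  have := norm_le_of_norm_replaceCoord_le hc hΛ le_rfl (a := a) (r := 0) (by simp [ha])
  simpa using this

variable [FiniteDimensional ℝ E] [MeasureSpace E] [BorelSpace E]
  [(volume : Measure E).IsAddHaarMeasure]

/-- Integration in the coordinate `q`, along which `Λ` is expanding, replaces `Λ a` by a free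
variable; the constant is uniform over all `Λ` with the given bounds. -/
theorem exists_setLIntegral_comp_clm_le {c M : ℝ} (hc : 0 < c) (ρ : ℝ) :
    ∃ K : ℝ≥0∞, K ≠ ∞ ∧ ∀ (Λ : (ι → E) →L[ℝ] E) (q : ι),
      (∀ e, c * ‖e‖ ≤ ‖Λ (Pi.single q e)‖) → ‖Λ‖ ≤ M → ∀ h : E → ℝ≥0∞, Measurable h →
      ∫⁻ a in Metric.closedBall (0 : ι → E) ρ, h (Λ a) ≤ K * ∫⁻ z, h z := by
  have hb1 : volume (Metric.ball (0 : ι → E) 1) ≠ 0 :=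
    (Metric.measure_ball_pos _ _ one_pos).ne'
  have hb2 : volume (Metric.ball (0 : ι → E) 1) ≠ ∞ := measure_ball_lt_top.ne
  refine ⟨volume (Metric.closedBall (0 : ι → E) (max 1 ((1 + M) / c))) /
    volume (Metric.ball (0 : ι → E) 1) *
      volume (Metric.closedBall (0 : E) ρ) ^ (Fintype.card ι - 1), ?_, ?_⟩
  · exact ENNReal.mul_ne_top (ENNReal.div_ne_top measure_closedBall_lt_top.ne hb1)
      (ENNReal.pow_ne_top measure_closedBall_lt_top.ne)
  intro Λ q hΛ hM h hh
  set Ψ := replaceCoord Λ q with hΨ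
  have hdet : LinearMap.det Ψ ≠ 0 := det_replaceCoord_ne_zero hc hΛ
  have hΨm : Measurable Ψ := Ψ.continuous_of_finiteDimensional.measurable
  -- the determinant is controlled by the volume of the preimage of the unit ball
  have hdet' : ENNReal.ofReal |(LinearMap.det Ψ)⁻¹| ≤
      volume (Metric.closedBall (0 : ι → E) (max 1 ((1 + M) / c))) /
        volume (Metric.ball (0 : ι → E) 1) := by
    rw [ENNReal.le_div_iff_mul_le (Or.inl hb1) (Or.inl hb2),
      ← Measure.addHaar_preimage_linearMap volume hdet]
    refine measure_mono fun a ha => ?_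
    have ha' : ‖Ψ a‖ ≤ 1 := by
      have : ‖Ψ a‖ < 1 := by simpa using ha
      exact this.le
    have := norm_le_of_norm_replaceCoord_le hc hΛ hM ha'
    simpa using this
  set t : ι → Set E := fun p => if p = q then Set.univ else Metric.closedBall 0 ρ with ht
  have htm : ∀ p, MeasurableSet (t p) := fun p => by
    simp only [ht]
    split_ifs
    · exact MeasurableSet.univ
    · exact Metric.isClosed_closedBall.measurableSet
  have htp : MeasurableSet (Set.univ.pi t) := MeasurableSet.univ_pi htm
  have hsub : Metric.closedBall (0 : ι → E) ρ ⊆ Ψ ⁻¹' Set.univ.pi t := by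
    intro a ha p _
    simp only [ht]
    split_ifs with hp
    · trivial
    · rw [hΨ, replaceCoord_apply_of_ne Λ hp, mem_closedBall_zero_iff]
      exact (norm_le_pi_norm a p).trans (by simpa using ha)
  calc ∫⁻ a in Metric.closedBall (0 : ι → E) ρ, h (Λ a)
      ≤ ∫⁻ a in Ψ ⁻¹' Set.univ.pi t, h (Ψ a q) := by
        simp only [hΨ, replaceCoord_apply_self]
        exact lintegral_mono_set hsub
    _ = ∫⁻ b in Set.univ.pi t, h (b q) ∂(Measure.map Ψ volume) := by
        have hm : Measurable fun b : ι → E => h (b q) := hh.comp (measurable_pi_apply q)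
        rw [setLIntegral_map htp hm hΨm]
    _ = ENNReal.ofReal |(LinearMap.det Ψ)⁻¹| * ∫⁻ b in Set.univ.pi t, h (b q) := by
        rw [Measure.map_linearMap_addHaar_eq_smul_addHaar volume hdet, Measure.restrict_smul,
          lintegral_smul_measure, smul_eq_mul]
    _ = ENNReal.ofReal |(LinearMap.det Ψ)⁻¹| *
        (volume (Metric.closedBall (0 : E) ρ) ^ (Fintype.card ι - 1) * ∫⁻ z, h z) := by
        congr 1
        rw [volume_pi, Measure.restrict_pi_pi]
        have h1 := Measure.pi_map_eval (fun p => (volume : Measure E).restrict (t p)) q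
        have h2 : ∏ j ∈ Finset.univ.erase q, (volume : Measure E).restrict (t j) Set.univ =
            volume (Metric.closedBall (0 : E) ρ) ^ (Fintype.card ι - 1) := by
          rw [Finset.prod_congr rfl (g := fun _ => volume (Metric.closedBall (0 : E) ρ))]
          · simp [Finset.card_erase_of_mem]
          · intro j hj
            simp [ht, Finset.ne_of_mem_erase hj]
        rw [h2] at h1
        have h3 : (volume : Measure E).restrict (t q) = volume := by simp [ht]
        rw [h3] at h1
        have h4 := lintegral_map (μ := Measure.pi fun p => (volume : Measure E).restrict (t p)) hh
          (measurable_pi_apply (X := fun _ : ι => E) q)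
        rw [← h4, ← smul_eq_mul, ← lintegral_smul_measure, ← h1]
    _ ≤ _ := by
        rw [← mul_assoc]
        gcongr

end ChangeOfVariables

/-! ### The coding map -/

theorem initialWord_zero (x : ℕ → ℕ) : initialWord x 0 = [] := rfl

theorem initialWord_succ (x : ℕ → ℕ) (k : ℕ) :
    initialWord x (k + 1) = initialWord x k ++ [x k] := by
  simp [initialWord, List.range_succ]

theorem initialWord_succ' (x : ℕ → ℕ) (k : ℕ) :
    initialWord x (k + 1) = x 0 :: initialWord (fun n => x (n + 1)) k := by
  simp [initialWord, List.range_succ_eq_map, Function.comp_def]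

@[simp]
theorem length_initialWord (x : ℕ → ℕ) (k : ℕ) : (initialWord x k).length = k := by
  simp [initialWord]

theorem initialWord_eq_iff {x y : ℕ → ℕ} {n : ℕ} :
    initialWord x n = initialWord y n ↔ ∀ k < n, x k = y k := by
  simp [initialWord]

theorem continuous_comp_initialWord {X : Type*} [TopologicalSpace X] (f : List ℕ → X) (n : ℕ) :
    Continuous fun x : ℕ → ℕ => f (initialWord x n) := by
  have h : (fun x : ℕ → ℕ => f (initialWord x n)) =
      (fun y : Fin n → ℕ => f (List.ofFn y)) ∘ fun x i => x i := by
    funext x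
    simp only [Function.comp_apply, initialWord]
    congr 1
    apply List.ext_getElem <;> simp
  rw [h]
  exact continuous_of_discreteTopology.comp (by fun_prop)

namespace AffineFamily

variable {D : ℕ} {L : Type*} {F : AffineFamily D L} {ω : List ℕ → L}

theorem cons_mem_words_iff {i : ℕ} {w : List ℕ} :
    i :: w ∈ F.words ω ↔ i < F.card (ω []) ∧ w ∈ F.words fun v => ω (i :: v) := by
  constructor
  · intro h
    exact ⟨h 0 (by simp), fun k hk => h (k + 1) (by simpa using hk)⟩
  · rintro ⟨h, hw⟩ k hk
    cases k with
    | zero => exact h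
    | succ k => exact hw k (by simpa using hk)

theorem lt_card_of_mem_paths {x : ℕ → ℕ} (hx : x ∈ F.paths ω) (k : ℕ) :
    x k < F.card (ω (initialWord x k)) := by
  have := hx (k + 1)
  rw [initialWord_succ, snoc_mem_words_iff] at this
  exact this.2

theorem tail_mem_paths {x : ℕ → ℕ} (hx : x ∈ F.paths ω) :
    (fun n => x (n + 1)) ∈ F.paths fun v => ω (x 0 :: v) := by
  intro n
  have := hx (n + 1)
  rw [initialWord_succ', cons_mem_words_iff] at this
  exact this.2

theorem linPart_injective (l : L) (i : ℕ) : Function.Injective (F.linPart l i) := by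
  unfold linPart
  split_ifs with h
  · exact ((F.lin l ⟨i, h⟩).equivOfDetNeZero (F.lin_nonsingular l ⟨i, h⟩)).injective
  · exact Function.injective_id

theorem lin_injective (l : L) (i : Fin (F.card l)) : Function.Injective (F.lin l i) :=
  ((F.lin l i).equivOfDetNeZero (F.lin_nonsingular l i)).injective

theorem wordLin_injective (ω : List ℕ → L) (w : List ℕ) :
    Function.Injective (F.wordLin ω w) := by
  induction w generalizing ω with
  | nil => exact Function.injective_id
  | cons i w ih => exact (linPart_injective _ _).comp (ih _)

/-- All the linear parts of the family have operator norm at most `σ`. -/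
def ContractsBy (F : AffineFamily D L) (σ : ℝ) : Prop :=
  ∀ l (i : Fin (F.card l)) z, ‖F.lin l i z‖ ≤ σ * ‖z‖

variable {σ : ℝ}

theorem ContractsBy.norm_wordLin_le (hF : F.ContractsBy σ) (hσ : 0 ≤ σ) {w : List ℕ}
    (hw : w ∈ F.words ω) (z : EuclideanSpace ℝ (Fin D)) :
    ‖F.wordLin ω w z‖ ≤ σ ^ w.length * ‖z‖ := by
  induction w generalizing ω with
  | nil => simp [wordLin]
  | cons i w ih =>
    obtain ⟨hi, hw⟩ := cons_mem_words_iff.1 hw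
    have h1 : F.linPart (ω []) i = F.lin (ω []) ⟨i, hi⟩ := by simp [linPart, hi]
    simp only [wordLin, LinearMap.comp_apply, h1, List.length_cons]
    refine (hF _ _ _).trans ?_
    calc σ * ‖F.wordLin (fun v => ω (i :: v)) w z‖ ≤ σ * (σ ^ w.length * ‖z‖) := by
          gcongr
          exact ih hw
      _ = σ ^ (w.length + 1) * ‖z‖ := by ring

/-- The equivalence class of the pair `(l, i)`. -/
def classOf (F : AffineFamily D L) (l : L) (i : Fin (F.card l)) : F.Classes :=
  Quotient.mk F.rel ⟨l, i⟩

/-- The translation vector of the map number `i` of `F^l` as a linear function of the parameter. -/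
noncomputable def translationCLM (F : AffineFamily D L) (l : L) (i : ℕ) :
    (F.Classes → EuclideanSpace ℝ (Fin D)) →L[ℝ] EuclideanSpace ℝ (Fin D) :=
  if h : i < F.card l then ContinuousLinearMap.proj (F.classOf l ⟨i, h⟩) else 0

theorem translationCLM_apply (l : L) (i : ℕ) (a : F.Classes → EuclideanSpace ℝ (Fin D)) :
    F.translationCLM l i a = F.translation a l i := by
  by_cases h : i < F.card l
  · rw [translationCLM, dif_pos h, translation, dif_pos h]
    rfl
  · simp [translationCLM, translation, h]

theorem norm_translation_le (l : L) (i : ℕ) (a : F.Classes → EuclideanSpace ℝ (Fin D)) :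
    ‖F.translation a l i‖ ≤ ‖a‖ := by
  unfold translation
  split_ifs
  · exact norm_le_pi_norm a _
  · simp

open scoped Classical in
/-- The linear dependence on the parameter of the `k`-th summand of the coding map. It is set to
zero once `x` has left the code tree, so that the series below converges for all sequences `x`. -/
noncomputable def codingTerm (F : AffineFamily D L) (ω : List ℕ → L) (k : ℕ) (x : ℕ → ℕ) :
    (F.Classes → EuclideanSpace ℝ (Fin D)) →L[ℝ] EuclideanSpace ℝ (Fin D) :=
  if initialWord x k ∈ F.words ω then
    LinearMap.toContinuousLinearMap (F.wordLin ω (initialWord x k)) ∘L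
      F.translationCLM (ω (initialWord x k)) (x k)
  else 0

theorem codingTerm_apply {x : ℕ → ℕ} (hx : x ∈ F.paths ω) (k : ℕ)
    (a : F.Classes → EuclideanSpace ℝ (Fin D)) : F.codingTerm ω k x a =
      F.wordLin ω (initialWord x k) (F.translation a (ω (initialWord x k)) (x k)) := by
  rw [codingTerm, if_pos (hx k)]
  simp [translationCLM_apply]

theorem ContractsBy.norm_codingTerm_le (hF : F.ContractsBy σ) (hσ : 0 ≤ σ) (k : ℕ) (x : ℕ → ℕ) :
    ‖F.codingTerm ω k x‖ ≤ σ ^ k := by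
  unfold codingTerm
  split_ifs with h
  · refine ContinuousLinearMap.opNorm_le_bound _ (by positivity) fun a => ?_
    simp only [ContinuousLinearMap.comp_apply, LinearMap.coe_toContinuousLinearMap',
      translationCLM_apply]
    refine (hF.norm_wordLin_le hσ h _).trans ?_
    rw [length_initialWord]
    gcongr
    exact norm_translation_le _ _ _
  · simpa using pow_nonneg hσ k

/-- The term depends only on an initial word of `x`, so it is locally constant. -/
theorem continuous_codingTerm (F : AffineFamily D L) (ω : List ℕ → L) (k : ℕ) :
    Continuous fun x => F.codingTerm ω k x := by
  classical
  have := continuous_comp_initialWord (fun w => if w.dropLast ∈ F.words ω then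
    LinearMap.toContinuousLinearMap (F.wordLin ω w.dropLast) ∘L
      F.translationCLM (ω w.dropLast) (w.getLastD 0) else 0) (k + 1)
  simpa [initialWord_succ, codingTerm] using this

/-- The coding map, which sends a path `x` to the point `lim f_{x_1 ⋯ x_k}(0)` as a linear function
of the parameter. -/
noncomputable def coding (F : AffineFamily D L) (ω : List ℕ → L) (x : ℕ → ℕ) :
    (F.Classes → EuclideanSpace ℝ (Fin D)) →L[ℝ] EuclideanSpace ℝ (Fin D) :=
  ∑' k, F.codingTerm ω k x

namespace ContractsBy

variable (hF : F.ContractsBy σ) (hσ0 : 0 ≤ σ) (hσ1 : σ < 1)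
include hF hσ0 hσ1

theorem summable_codingTerm (ω : List ℕ → L) (x : ℕ → ℕ) :
    Summable fun k => F.codingTerm ω k x :=
  Summable.of_norm_bounded (summable_geometric_of_lt_one hσ0 hσ1) fun k =>
    hF.norm_codingTerm_le hσ0 k x

theorem norm_coding_le (ω : List ℕ → L) (x : ℕ → ℕ) : ‖F.coding ω x‖ ≤ (1 - σ)⁻¹ :=
  tsum_of_norm_bounded (hasSum_geometric_of_lt_one hσ0 hσ1) fun k => hF.norm_codingTerm_le hσ0 k x

theorem continuous_coding (ω : List ℕ → L) : Continuous (F.coding ω) :=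
  continuous_tsum (F.continuous_codingTerm ω) (summable_geometric_of_lt_one hσ0 hσ1) fun k x =>
    hF.norm_codingTerm_le hσ0 k x

theorem hasSum_codingTerm_apply (ω : List ℕ → L) (x : ℕ → ℕ)
    (a : F.Classes → EuclideanSpace ℝ (Fin D)) :
    HasSum (fun k => F.codingTerm ω k x a) (F.coding ω x a) :=
  (hF.summable_codingTerm hσ0 hσ1 ω x).hasSum.mapL
    (ContinuousLinearMap.apply ℝ (EuclideanSpace ℝ (Fin D)) a)

theorem coding_eq_add {x : ℕ → ℕ} (hx : x ∈ F.paths ω)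
    (a : F.Classes → EuclideanSpace ℝ (Fin D)) :
    F.coding ω x a = F.affMap a (ω []) (x 0)
      (F.coding (fun v => ω (x 0 :: v)) (fun n => x (n + 1)) a) := by
  have h1 := (hF.hasSum_codingTerm_apply hσ0 hσ1 ω x a)
  have h2 := (hF.hasSum_codingTerm_apply hσ0 hσ1 (fun v => ω (x 0 :: v))
    (fun n => x (n + 1)) a).mapL (LinearMap.toContinuousLinearMap (F.linPart (ω []) (x 0)))
  rw [← h1.tsum_eq, h1.summable.tsum_eq_zero_add, affMap, add_comm]
  congr 1
  · rw [← LinearMap.coe_toContinuousLinearMap' (F.linPart (ω []) (x 0)), ← h2.tsum_eq]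
    refine tsum_congr fun k => ?_
    rw [codingTerm_apply hx, codingTerm_apply (tail_mem_paths hx), initialWord_succ']
    rfl
  · rw [codingTerm_apply hx]
    rfl

/-- A path splits after `n` letters into an initial word and a path of the code tree that is
rooted at this word. -/
theorem coding_eq_add_wordLin {x : ℕ → ℕ} (hx : x ∈ F.paths ω) (n : ℕ)
    (a : F.Classes → EuclideanSpace ℝ (Fin D)) :
    (fun k => x (n + k)) ∈ F.paths (fun v => ω (initialWord x n ++ v)) ∧
    F.coding ω x a = F.wordMap a ω (initialWord x n) 0 + F.wordLin ω (initialWord x n)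
      (F.coding (fun v => ω (initialWord x n ++ v)) (fun k => x (n + k)) a) := by
  induction n generalizing ω x with
  | zero => simpa [initialWord_zero, wordMap, wordLin] using hx
  | succ n ih =>
    obtain ⟨h1, h2⟩ := ih (tail_mem_paths hx)
    rw [initialWord_succ']
    have hfun : (fun k => x (n + 1 + k)) = fun k => x (n + k + 1) := by
      funext k
      congr 1
      omega
    rw [hfun]
    refine ⟨h1, ?_⟩
    rw [hF.coding_eq_add hσ0 hσ1 hx, h2]
    simp only [affMap, wordMap, wordLin, Function.comp_apply, LinearMap.comp_apply, map_add,
      List.cons_append]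
    abel

theorem tendsto_wordMap {x : ℕ → ℕ} (hx : x ∈ F.paths ω)
    (a : F.Classes → EuclideanSpace ℝ (Fin D)) :
    Tendsto (fun k => F.wordMap a ω (initialWord x k) 0) atTop (𝓝 (F.coding ω x a)) := by
  -- the remainder `T_{x_1 ⋯ x_k} (π(x_{k+1} x_{k+2} ⋯))` is at most `σ ^ k * ‖a‖ / (1 - σ)`
  rw [tendsto_iff_norm_sub_tendsto_zero]
  have h0 : Tendsto (fun k : ℕ => σ ^ k * ((1 - σ)⁻¹ * ‖a‖)) atTop (𝓝 0) := by
    simpa using (tendsto_pow_atTop_nhds_zero_of_lt_one hσ0 hσ1).mul_const ((1 - σ)⁻¹ * ‖a‖)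
  refine squeeze_zero (fun _ => norm_nonneg _) (fun k => ?_) h0
  rw [norm_sub_rev, (hF.coding_eq_add_wordLin hσ0 hσ1 hx k a).2, add_sub_cancel_left]
  refine (hF.norm_wordLin_le hσ0 (hx k) _).trans ?_
  rw [length_initialWord]
  gcongr
  exact (ContinuousLinearMap.le_opNorm _ _).trans
    (by gcongr; exact hF.norm_coding_le hσ0 hσ1 _ _)

theorem attractor_eq_image (a : F.Classes → EuclideanSpace ℝ (Fin D)) (ω : List ℕ → L) :
    F.attractor a ω = (fun x => F.coding ω x a) '' F.paths ω := by
  ext z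
  constructor
  · rintro ⟨x, hx, hz⟩
    exact ⟨x, hx, tendsto_nhds_unique (hF.tendsto_wordMap hσ0 hσ1 hx a) hz⟩
  · rintro ⟨x, hx, rfl⟩
    exact ⟨x, hx, hF.tendsto_wordMap hσ0 hσ1 hx a⟩

end ContractsBy

end AffineFamily

/-! ### Transversality -/

namespace AffineFamily

variable {D : ℕ} {L : Type*} {F : AffineFamily D L} {ω : List ℕ → L} {σ : ℝ}

/-- The equivalence class of the `k`-th letter of a path, that is, the label of the translation
vector which enters the `k`-th summand of the coding map. -/
def letterClass {x : ℕ → ℕ} (hx : x ∈ F.paths ω) (k : ℕ) : F.Classes :=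
  F.classOf (ω (initialWord x k)) ⟨x k, lt_card_of_mem_paths hx k⟩

theorem letterClass_zero_ne {x y : ℕ → ℕ} (hx : x ∈ F.paths ω) (hy : y ∈ F.paths ω)
    (h : x 0 ≠ y 0) : letterClass hx 0 ≠ letterClass hy 0 := by
  intro heq
  have h1 := (F.rel_iff (ω []) ⟨x 0, lt_card_of_mem_paths hx 0⟩
    ⟨y 0, lt_card_of_mem_paths hy 0⟩).1 (Quotient.exact heq)
  exact h (congrArg Fin.val h1)

open scoped Classical in
theorem codingTerm_single {x : ℕ → ℕ} (hx : x ∈ F.paths ω) (k : ℕ) (q : F.Classes)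
    (e : EuclideanSpace ℝ (Fin D)) : F.codingTerm ω k x (Pi.single q e) =
      if letterClass hx k = q then F.wordLin ω (initialWord x k) e else 0 := by
  rw [codingTerm_apply hx, translation, dif_pos (lt_card_of_mem_paths hx k)]
  split_ifs with h
  · subst h
    exact congrArg _ (Pi.single_eq_same (M := fun _ : F.Classes => EuclideanSpace ℝ (Fin D)) _ e)
  · have : (Pi.single q e : F.Classes → EuclideanSpace ℝ (Fin D)) (letterClass hx k) = 0 :=
      Pi.single_eq_of_ne (M := fun _ : F.Classes => EuclideanSpace ℝ (Fin D)) h e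
    exact (congrArg _ this).trans (map_zero _)

open scoped Classical in
/-- Apart from the contribution of its first letter, the coding of a path depends on the
translation vector with label `q` by a linear map of norm at most `c q`. As each letter belongs to only one class, the errors for two
different classes add up to at most `σ + σ² + ⋯ = σ / (1 - σ)`. -/
theorem ContractsBy.exists_norm_coding_single_sub_le (hF : F.ContractsBy σ) (hσ0 : 0 ≤ σ)
    (hσ1 : σ < 1) {x : ℕ → ℕ} (hx : x ∈ F.paths ω) :
    ∃ c : F.Classes → ℝ, (∀ q e, ‖F.coding ω x (Pi.single q e) -
      (if letterClass hx 0 = q then e else 0)‖ ≤ c q * ‖e‖) ∧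
      ∀ q q', q ≠ q' → c q + c q' ≤ σ / (1 - σ) := by
  have hgeo : HasSum (fun k => σ ^ (k + 1)) (σ / (1 - σ)) := by
    simpa [pow_succ', div_eq_mul_inv] using (hasSum_geometric_of_lt_one hσ0 hσ1).mul_left σ
  set b : F.Classes → ℕ → ℝ := fun q k => if letterClass hx (k + 1) = q then σ ^ (k + 1) else 0
    with hb
  have hb0 : ∀ q k, 0 ≤ b q k := fun q k => by
    simp only [hb]
    split_ifs <;> positivity
  have hble : ∀ q k, b q k ≤ σ ^ (k + 1) := fun q k => by
    simp only [hb]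
    split_ifs
    · exact le_rfl
    · positivity
  have hbs : ∀ q, Summable (b q) := fun q =>
    Summable.of_nonneg_of_le (hb0 q) (hble q) hgeo.summable
  refine ⟨fun q => ∑' k, b q k, fun q e => ?_, fun q q' hqq => ?_⟩
  · have h1 := hF.hasSum_codingTerm_apply hσ0 hσ1 ω x (Pi.single q e)
    have h2 : F.codingTerm ω 0 x (Pi.single q e) = if letterClass hx 0 = q then e else 0 := by
      rw [codingTerm_single hx]
      rfl
    rw [← h1.tsum_eq, h1.summable.tsum_eq_zero_add, h2, add_sub_cancel_left]
    refine tsum_of_norm_bounded ((hbs q).hasSum.mul_right ‖e‖) fun k => ?_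
    rw [codingTerm_single hx]
    simp only [hb]
    split_ifs
    · simpa using hF.norm_wordLin_le hσ0 (hx (k + 1)) e
    · simp
  · rw [← (hbs q).tsum_add (hbs q')]
    refine hasSum_le (fun k => ?_) ((hbs q).add (hbs q')).hasSum hgeo
    simp only [hb]
    have := pow_nonneg hσ0 (k + 1)
    split_ifs with h1 h2 h2
    · exact absurd (h1.symm.trans h2) hqq
    all_goals simp [this]

open scoped Classical in
/-- If two paths differ in the first letter, then the difference of their codings is
expanding in the translation vector of one of these two letters, by at least `1 - σ / (1 - σ)`,
which is positive for `σ < 1/2`. -/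
theorem ContractsBy.exists_le_norm_coding_sub_single (hF : F.ContractsBy σ) (hσ0 : 0 ≤ σ)
    (hσ1 : σ < 1) {x y : ℕ → ℕ} (hx : x ∈ F.paths ω) (hy : y ∈ F.paths ω) (hxy : x 0 ≠ y 0) :
    ∃ q, ∀ e, (1 - σ / (1 - σ)) * ‖e‖ ≤
      ‖(F.coding ω x - F.coding ω y) (Pi.single q e)‖ := by
  obtain ⟨c, hc, hc'⟩ := hF.exists_norm_coding_single_sub_le hσ0 hσ1 hx
  obtain ⟨d, hd, hd'⟩ := hF.exists_norm_coding_single_sub_le hσ0 hσ1 hy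
  have hne := letterClass_zero_ne hx hy hxy
  set u := letterClass hx 0 with hu
  set v := letterClass hy 0 with hv
  have h1 := hc' u v hne
  have h2 := hd' u v hne
  -- the four errors add up to at most `2 σ / (1 - σ)`, so those of one class to at most half of it
  rcases le_total (c u + d u) (c v + d v) with h | h
  · refine ⟨u, fun e => ?_⟩
    have hcu := hc u e
    have hdu := hd u e
    rw [if_pos rfl] at hcu
    rw [if_neg hne.symm, sub_zero] at hdu
    set p := F.coding ω x (Pi.single u e)
    set r := F.coding ω y (Pi.single u e)
    have h3 : ‖e‖ ≤ ‖p - r‖ + (‖p - e‖ + ‖r‖) := by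
      have : e = (p - r) - (p - e) + r := by abel
      calc ‖e‖ = ‖(p - r) - (p - e) + r‖ := by rw [← this]
        _ ≤ ‖(p - r) - (p - e)‖ + ‖r‖ := norm_add_le _ _
        _ ≤ ‖p - r‖ + ‖p - e‖ + ‖r‖ := by gcongr; exact norm_sub_le _ _
        _ = _ := by ring
    have h4 : (c u + d u) * ‖e‖ ≤ σ / (1 - σ) * ‖e‖ := by gcongr; linarith
    change _ ≤ ‖p - r‖
    linarith
  · refine ⟨v, fun e => ?_⟩
    have hcu := hc v e
    have hdu := hd v e
    rw [if_pos rfl] at hdu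
    rw [if_neg hne, sub_zero] at hcu
    set p := F.coding ω x (Pi.single v e)
    set r := F.coding ω y (Pi.single v e)
    have h3 : ‖e‖ ≤ ‖p - r‖ + (‖p‖ + ‖r - e‖) := by
      have : e = p - (p - r) - (r - e) := by abel
      calc ‖e‖ = ‖p - (p - r) - (r - e)‖ := by rw [← this]
        _ ≤ ‖p - (p - r)‖ + ‖r - e‖ := norm_sub_le _ _
        _ ≤ ‖p‖ + ‖p - r‖ + ‖r - e‖ := by gcongr; exact norm_sub_le _ _
        _ = _ := by ring
    have h4 : (c v + d v) * ‖e‖ ≤ σ / (1 - σ) * ‖e‖ := by gcongr; linarith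
    change _ ≤ ‖p - r‖
    linarith

/-- The parameter average of the kernel `‖π(x) - π(y)‖^{-θ s}` is bounded in terms of the common
initial word of the two paths. -/
theorem ContractsBy.exists_setLIntegral_coding_sub_rpow_neg_le (hF : F.ContractsBy σ)
    (hσ0 : 0 ≤ σ) (hσ1 : σ < 1 / 2) (hD : 0 < D) {s : ℝ≥0} (hs : (s : ℝ) < D)
    {θ : ℝ} (hθ0 : 0 ≤ θ) (hθ : θ < 1) (ρ : ℝ) (ω : List ℕ → L) :
    ∃ C : ℝ≥0∞, C ≠ ∞ ∧ ∀ x ∈ F.paths ω, ∀ y ∈ F.paths ω, ∀ n : ℕ,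
      initialWord x n = initialWord y n → x n ≠ y n →
      ∫⁻ a in Metric.closedBall (0 : F.Classes → EuclideanSpace ℝ (Fin D)) ρ,
        ‖F.coding ω x a - F.coding ω y a‖ₑ ^ (-(θ * s)) ≤
          C * ENNReal.ofReal (singularValueFunction s (F.wordLin ω (initialWord x n))) ^ (-θ) := by
  classical
  have hσ1' : σ < 1 := by linarith
  have hc : 0 < 1 - σ / (1 - σ) := by
    rw [sub_pos, div_lt_one (by linarith)]
    linarith
  obtain ⟨C, hC, hC'⟩ := exists_lintegral_enorm_map_rpow_neg_le hD hs hθ0 hθ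
    (((1 - σ)⁻¹ + (1 - σ)⁻¹) * ρ)
  obtain ⟨K, hK, hK'⟩ := exists_setLIntegral_comp_clm_le (ι := F.Classes)
    (E := EuclideanSpace ℝ (Fin D)) (M := (1 - σ)⁻¹ + (1 - σ)⁻¹) hc ρ
  refine ⟨K * C, ENNReal.mul_ne_top hK hC, fun x hx y hy n hxy hn => ?_⟩
  set T := F.wordLin ω (initialWord x n) with hT
  set x' : ℕ → ℕ := fun k => x (n + k) with hx'
  set y' : ℕ → ℕ := fun k => y (n + k) with hy'
  set ω' : List ℕ → L := fun v => ω (initialWord x n ++ v) with hω'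
  have hxp : x' ∈ F.paths ω' := (hF.coding_eq_add_wordLin hσ0 hσ1' hx n 0).1
  have hyp : y' ∈ F.paths ω' := by
    have := (hF.coding_eq_add_wordLin hσ0 hσ1' hy n 0).1
    rwa [← hxy] at this
  set Λ := F.coding ω' x' - F.coding ω' y' with hΛ
  have hΛn : ‖Λ‖ ≤ (1 - σ)⁻¹ + (1 - σ)⁻¹ := (norm_sub_le _ _).trans
    (add_le_add (hF.norm_coding_le hσ0 hσ1' _ _) (hF.norm_coding_le hσ0 hσ1' _ _))
  obtain ⟨q, hq⟩ := hF.exists_le_norm_coding_sub_single hσ0 hσ1' hxp hyp hn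
  have hdiff : ∀ a, F.coding ω x a - F.coding ω y a = T (Λ a) := by
    intro a
    rw [(hF.coding_eq_add_wordLin hσ0 hσ1' hx n a).2, (hF.coding_eq_add_wordLin hσ0 hσ1' hy n a).2,
      ← hxy, add_sub_add_left_eq_sub, ← map_sub]
    rfl
  have hTm : Measurable fun z => ‖T z‖ₑ ^ (-(θ * s)) := by
    have : Measurable T := T.continuous_of_finiteDimensional.measurable
    exact this.enorm.pow_const _
  set B := Metric.closedBall (0 : EuclideanSpace ℝ (Fin D)) (((1 - σ)⁻¹ + (1 - σ)⁻¹) * ρ) with hB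
  have hBm : MeasurableSet B := Metric.isClosed_closedBall.measurableSet
  calc ∫⁻ a in Metric.closedBall (0 : F.Classes → EuclideanSpace ℝ (Fin D)) ρ,
        ‖F.coding ω x a - F.coding ω y a‖ₑ ^ (-(θ * s))
      = ∫⁻ a in Metric.closedBall (0 : F.Classes → EuclideanSpace ℝ (Fin D)) ρ,
        B.indicator (fun z => ‖T z‖ₑ ^ (-(θ * s))) (Λ a) := by
        refine setLIntegral_congr_fun Metric.isClosed_closedBall.measurableSet fun a ha => ?_
        have haB : Λ a ∈ B := by
          rw [hB, mem_closedBall_zero_iff]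
          refine (Λ.le_opNorm a).trans ?_
          have h1 : 0 < 1 - σ := by linarith
          have : ‖a‖ ≤ ρ := by simpa using ha
          gcongr
        simp only [Set.indicator_of_mem haB, hdiff]
    _ ≤ K * ∫⁻ z, B.indicator (fun z => ‖T z‖ₑ ^ (-(θ * s))) z :=
        hK' Λ q hq hΛn _ (hTm.indicator hBm)
    _ ≤ K * (C * ENNReal.ofReal (singularValueFunction s T) ^ (-θ)) := by
        rw [lintegral_indicator hBm]
        gcongr
        exact hC' T (wordLin_injective _ _)
    _ = _ := by rw [mul_assoc]

end AffineFamily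

/-! ### A Frostman measure on the code tree -/

section RandomPath

/-- The sequences with initial word `w`. -/
def wordSet (w : List ℕ) : Set (ℕ → ℕ) :=
  {x | initialWord x w.length = w}

theorem measurableSet_setOf_initialWord (n : ℕ) (p : List ℕ → Prop) :
    MeasurableSet {x : ℕ → ℕ | p (initialWord x n)} := by
  have h := continuous_comp_initialWord p n
  rw [continuous_Prop] at h
  exact h.measurableSet

theorem measurableSet_wordSet (w : List ℕ) : MeasurableSet (wordSet w) :=
  measurableSet_setOf_initialWord w.length (· = w)

open ProbabilityTheory in
/-- The law of the random sequence whose letters are chosen one after the other, the next letter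
after the word `w` having the distribution `p w`. -/
theorem exists_isProbabilityMeasure_wordSet_snoc (p : List ℕ → PMF ℕ) :
    ∃ μ : Measure (ℕ → ℕ), IsProbabilityMeasure μ ∧
      ∀ w i, μ (wordSet (w ++ [i])) = μ (wordSet w) * p w i := by
  -- the coordinate `0` of the trajectories is a dummy, the letters have the indices `1, 2, …`
  let word : (n : ℕ) → ((Finset.Iic n) → ℕ) → List ℕ := fun n y =>
    List.ofFn fun k : Fin n => y ⟨k + 1, Finset.mem_Iic.2 k.2⟩
  let κ : (n : ℕ) → Kernel ((i : Finset.Iic n) → (fun _ : ℕ => ℕ) i) ((fun _ : ℕ => ℕ) (n + 1)) :=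
    fun n => Kernel.ofFunOfCountable fun y => (p (word n y)).toMeasure
  have hκ : ∀ n, IsMarkovKernel (κ n) := fun n => ⟨fun y => by
    change IsProbabilityMeasure ((p (word n y)).toMeasure)
    infer_instance⟩
  let P : Measure (ℕ → ℕ) := Kernel.trajMeasure (X := fun _ => ℕ) (Measure.dirac 0) κ
  have hP : IsProbabilityMeasure P :=
    inferInstanceAs (IsProbabilityMeasure
      (Kernel.trajMeasure (X := fun _ => ℕ) (Measure.dirac 0) κ))
  have hshift : Measurable fun (y : ℕ → ℕ) (k : ℕ) => y (k + 1) := by fun_prop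
  refine ⟨P.map fun y k => y (k + 1), Measure.isProbabilityMeasure_map hshift.aemeasurable,
    fun w i => ?_⟩
  rw [Measure.map_apply hshift (measurableSet_wordSet _),
    Measure.map_apply hshift (measurableSet_wordSet _)]
  set n := w.length with hn
  have hword : ∀ y : ℕ → ℕ, word n (Preorder.frestrictLe (π := fun _ => ℕ) n y) =
      initialWord (fun k => y (k + 1)) n := by
    intro y
    simp only [word, initialWord]
    apply List.ext_getElem <;> simp
  set A : Set ((Finset.Iic n) → ℕ) := {z | word n z = w} with hA
  have hAm : MeasurableSet A := (Set.to_countable A).measurableSet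
  have key := Kernel.map_frestrictLe_trajMeasure_compProd_eq_map_trajMeasure
    (X := fun _ => ℕ) (μ₀ := Measure.dirac 0) (κ := κ) (a := n)
  have key2 := congrArg (fun m => m (A ×ˢ {i})) key
  have hr : Measurable (Preorder.frestrictLe (π := fun _ : ℕ => ℕ) n) := by fun_prop
  beta_reduce at key2
  rw [Measure.compProd_apply_prod hAm (measurableSet_singleton i),
    Measure.map_apply (by fun_prop) (hAm.prod (measurableSet_singleton i)),
    setLIntegral_congr_fun (g := fun _ => p w i) hAm, setLIntegral_const,
    Measure.map_apply hr hAm, mul_comm] at key2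
  · have h1 : (fun (y : ℕ → ℕ) (k : ℕ) => y (k + 1)) ⁻¹' wordSet w =
        Preorder.frestrictLe (π := fun _ : ℕ => ℕ) n ⁻¹' A := by
      ext y
      simp only [Set.mem_preimage, hA, Set.mem_ofPred_eq, hword, wordSet]
      rfl
    have h2 : (fun (y : ℕ → ℕ) (k : ℕ) => y (k + 1)) ⁻¹' wordSet (w ++ [i]) =
        (fun y : ℕ → ℕ => (Preorder.frestrictLe (π := fun _ : ℕ => ℕ) n y, y (n + 1))) ⁻¹'
          (A ×ˢ {i}) := by
      ext y
      simp only [Set.mem_preimage, Set.mem_prod, hA, Set.mem_ofPred_eq, hword, wordSet,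
        List.length_append, List.length_singleton, initialWord_succ, Set.mem_singleton_iff]
      rw [← hn, ← List.concat_eq_append, ← List.concat_eq_append]
      exact List.concat_inj
    rw [h1, h2]
    exact key2.symm
  · intro z hz
    have hz' : word n z = w := hz
    change (p (word n z)).toMeasure {i} = p w i
    rw [hz', PMF.toMeasure_apply_singleton _ _ (measurableSet_singleton i)]

end RandomPath

namespace AffineFamily

variable {D : ℕ} {L : Type*} {F : AffineFamily D L} {ω : List ℕ → L} {s : ℝ≥0}

theorem preNaturalMeasure_le_tsum {j : ℕ} {E : Set (ℕ → ℕ)} {J : Set (List ℕ)}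
    (h1 : J ⊆ F.words ω) (h2 : ∀ w ∈ J, j ≤ w.length) (h3 : E ⊆ ⋃ w ∈ J, F.cylinder ω w) :
    F.preNaturalMeasure ω s j E ≤
      ∑' w : J, ENNReal.ofReal (singularValueFunction s (F.wordLin ω w)) :=
  iInf_le_of_le J (iInf_le_of_le h1 (iInf_le_of_le h2 (iInf_le_of_le h3 le_rfl)))

theorem exists_cover_of_preNaturalMeasure_lt {j : ℕ} {E : Set (ℕ → ℕ)} {c : ℝ≥0∞}
    (h : F.preNaturalMeasure ω s j E < c) :
    ∃ J : Set (List ℕ), J ⊆ F.words ω ∧ (∀ w ∈ J, j ≤ w.length) ∧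
      E ⊆ ⋃ w ∈ J, F.cylinder ω w ∧
      ∑' w : J, ENNReal.ofReal (singularValueFunction s (F.wordLin ω w)) < c := by
  unfold preNaturalMeasure at h
  simp only [iInf_lt_iff] at h
  obtain ⟨J, h1, h2, h3, h4⟩ := h
  exact ⟨J, h1, h2, h3, h4⟩

theorem preNaturalMeasure_le_tsum_of_subset_iUnion {j : ℕ} {E : Set (ℕ → ℕ)}
    {E' : ℕ → Set (ℕ → ℕ)} (hE : E ⊆ ⋃ i, E' i) :
    F.preNaturalMeasure ω s j E ≤ ∑' i, F.preNaturalMeasure ω s j (E' i) := by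
  refine ENNReal.le_of_forall_pos_le_add fun ε hε htop => ?_
  obtain ⟨δ, hδ, hδε⟩ := ENNReal.exists_pos_sum_of_countable (ENNReal.coe_pos.2 hε).ne' ℕ
  have hlt : ∀ i, F.preNaturalMeasure ω s j (E' i) < F.preNaturalMeasure ω s j (E' i) + δ i :=
    fun i => ENNReal.lt_add_right (ENNReal.ne_top_of_tsum_ne_top htop.ne i)
      (by simpa using (hδ i).ne')
  choose J h1 h2 h3 h4 using fun i => exists_cover_of_preNaturalMeasure_lt (hlt i)
  calc F.preNaturalMeasure ω s j E
      ≤ ∑' w : ⋃ i, J i, ENNReal.ofReal (singularValueFunction s (F.wordLin ω w)) := by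
        refine preNaturalMeasure_le_tsum (Set.iUnion_subset h1) ?_ ?_
        · intro w hw
          obtain ⟨i, hi⟩ := Set.mem_iUnion.1 hw
          exact h2 i w hi
        · intro x hx
          obtain ⟨i, hi⟩ := Set.mem_iUnion.1 (hE hx)
          obtain ⟨w, hw, hxw⟩ := Set.mem_iUnion₂.1 (h3 i hi)
          exact Set.mem_iUnion₂.2 ⟨w, Set.mem_iUnion.2 ⟨i, hw⟩, hxw⟩
    _ ≤ ∑' i, ∑' w : J i, ENNReal.ofReal (singularValueFunction s (F.wordLin ω w)) :=
        ENNReal.tsum_iUnion_le_tsum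
          (fun w => ENNReal.ofReal (singularValueFunction s (F.wordLin ω w))) J
    _ ≤ ∑' i, (F.preNaturalMeasure ω s j (E' i) + δ i) := ENNReal.tsum_le_tsum fun i => (h4 i).le
    _ = ∑' i, F.preNaturalMeasure ω s j (E' i) + ∑' i, (δ i : ℝ≥0∞) := ENNReal.tsum_add
    _ ≤ _ := by gcongr

theorem preNaturalMeasure_cylinder_of_notMem {j : ℕ} {w : List ℕ} (hw : w ∉ F.words ω) :
    F.preNaturalMeasure ω s j (F.cylinder ω w) = 0 := by
  have h : F.cylinder ω w ⊆ ⋃ v ∈ (∅ : Set (List ℕ)), F.cylinder ω v := by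
    rintro x ⟨hx, hxw⟩
    exact absurd (hxw ▸ hx w.length) hw
  have := preNaturalMeasure_le_tsum (F := F) (ω := ω) (s := s) (j := j)
    (Set.empty_subset _) (by simp) h
  simpa using this

theorem preNaturalMeasure_cylinder_le (w : List ℕ) :
    F.preNaturalMeasure ω s 0 (F.cylinder ω w) ≤
      ENNReal.ofReal (singularValueFunction s (F.wordLin ω w)) := by
  by_cases hw : w ∈ F.words ω
  · refine (preNaturalMeasure_le_tsum (J := {w}) (by simpa using hw) (by simp) (by simp)).trans ?_
    rw [tsum_singleton w (fun w => ENNReal.ofReal (singularValueFunction s (F.wordLin ω w)))]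
  · rw [preNaturalMeasure_cylinder_of_notMem hw]
    exact zero_le

theorem cylinder_subset_iUnion_snoc (w : List ℕ) :
    F.cylinder ω w ⊆ ⋃ i, F.cylinder ω (w ++ [i]) := by
  rintro x ⟨hx, hxw⟩
  refine Set.mem_iUnion.2 ⟨x w.length, hx, ?_⟩
  rw [List.length_append, List.length_singleton, initialWord_succ, hxw]

theorem cylinder_nil : F.cylinder ω [] = F.paths ω := by
  ext x
  simp [cylinder, initialWord]

theorem tsum_preNaturalMeasure_snoc_ne_top (w : List ℕ) :
    ∑' i, F.preNaturalMeasure ω s 0 (F.cylinder ω (w ++ [i])) ≠ ∞ := by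
  rw [tsum_eq_sum (s := Finset.range (F.card (ω w)))]
  · exact ENNReal.sum_ne_top.2 fun i _ => ne_top_of_le_ne_top ENNReal.ofReal_ne_top
      (preNaturalMeasure_cylinder_le _)
  · intro i hi
    refine preNaturalMeasure_cylinder_of_notMem fun h => hi ?_
    exact Finset.mem_range.2 ((F.snoc_mem_words_iff ω w i).1 h).2

theorem finite_words_length_eq (F : AffineFamily D L) (ω : List ℕ → L) (n : ℕ) :
    {w ∈ F.words ω | w.length = n}.Finite := by
  obtain ⟨B, hB⟩ := F.card_bdd
  induction n with
  | zero =>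
    refine (Set.finite_singleton []).subset fun w hw => ?_
    exact List.length_eq_zero_iff.1 hw.2
  | succ n ih =>
    refine ((ih.prod (Set.finite_Iio B)).image fun q : List ℕ × ℕ => q.1 ++ [q.2]).subset ?_
    rintro w ⟨hw, hn⟩
    obtain ⟨v, i, rfl⟩ : ∃ v i, w = v ++ [i] := by
      rcases List.eq_nil_or_concat w with rfl | ⟨v, i, rfl⟩
      · simp at hn
      · exact ⟨v, i, by simp⟩
    obtain ⟨hv, hi⟩ := (F.snoc_mem_words_iff ω v i).1 hw
    exact ⟨(v, i), ⟨⟨hv, by simpa using hn⟩, lt_of_lt_of_le hi (hB ⟨_, rfl⟩)⟩, rfl⟩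

/-- As there are only finitely many short words and all singular values are positive, coverings
with small sums consist of long words. -/
theorem preNaturalMeasure_eq_zero_of_zero (hs : (s : ℝ) < D) {E : Set (ℕ → ℕ)}
    (h : F.preNaturalMeasure ω s 0 E = 0) (j : ℕ) : F.preNaturalMeasure ω s j E = 0 := by
  have hfin : {w ∈ F.words ω | w.length < j}.Finite := by
    refine ((Set.finite_Iio j).biUnion fun n _ => F.finite_words_length_eq ω n).subset ?_
    rintro w ⟨hw, hj⟩
    exact Set.mem_iUnion₂.2 ⟨w.length, hj, hw, rfl⟩
  obtain ⟨δ, hδ0, hδ⟩ : ∃ δ : ℝ≥0∞, 0 < δ ∧ ∀ w ∈ F.words ω, w.length < j →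
      δ ≤ ENNReal.ofReal (singularValueFunction s (F.wordLin ω w)) := by
    refine ⟨⨅ w ∈ hfin.toFinset, ENNReal.ofReal (singularValueFunction s (F.wordLin ω w)), ?_, ?_⟩
    · rw [← Finset.inf_eq_iInf, Finset.lt_inf_iff (by simp)]
      intro w _
      exact ENNReal.ofReal_pos.2 (singularValueFunction_pos (wordLin_injective ω w) hs)
    · intro w hw hwj
      exact iInf₂_le w (hfin.mem_toFinset.2 ⟨hw, hwj⟩)
  refine le_antisymm (le_of_forall_gt fun ε hε => ?_) zero_le
  have hpos : F.preNaturalMeasure ω s 0 E < min ε δ := by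
    rw [h]
    exact lt_min hε hδ0
  obtain ⟨J, h1, -, h3, h4⟩ := exists_cover_of_preNaturalMeasure_lt hpos
  refine lt_of_le_of_lt (preNaturalMeasure_le_tsum h1 (fun w hw => ?_) h3)
    (h4.trans_le (min_le_left _ _))
  by_contra! hj
  have h5 : ENNReal.ofReal (singularValueFunction s (F.wordLin ω w)) < δ :=
    lt_of_le_of_lt (ENNReal.le_tsum (⟨w, hw⟩ : J)) (h4.trans_le (min_le_right _ _))
  exact absurd (hδ w (h1 hw) hj) (not_le.2 h5)

/-- **Frostman's lemma** on the code tree. The mass is distributed from a word to its successors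
proportionally to their contents; by subadditivity of the content, the mass of a cylinder
never exceeds its content by more than a constant factor. -/
theorem exists_frostman_measure (hs : (s : ℝ) < D)
    (h : F.naturalMeasure ω s (F.paths ω) ≠ 0) :
    ∃ μ : Measure (ℕ → ℕ), IsProbabilityMeasure μ ∧ μ (F.paths ω)ᶜ = 0 ∧
      ∃ C : ℝ≥0∞, C ≠ ∞ ∧ ∀ w, μ (wordSet w) ≤
        C * ENNReal.ofReal (singularValueFunction s (F.wordLin ω w)) := by
  set c : List ℕ → ℝ≥0∞ := fun w => F.preNaturalMeasure ω s 0 (F.cylinder ω w) with hc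
  have hcle : ∀ w, c w ≤ ENNReal.ofReal (singularValueFunction s (F.wordLin ω w)) :=
    preNaturalMeasure_cylinder_le
  have hctop : ∀ w, c w ≠ ∞ := fun w => ne_top_of_le_ne_top ENNReal.ofReal_ne_top (hcle w)
  have hsub : ∀ w, c w ≤ ∑' i, c (w ++ [i]) := fun w =>
    preNaturalMeasure_le_tsum_of_subset_iUnion (cylinder_subset_iUnion_snoc w)
  have hc0 : c [] ≠ 0 := by
    intro h0
    rw [hc] at h0
    simp only [cylinder_nil] at h0
    refine h ?_
    rw [naturalMeasure]
    simp [preNaturalMeasure_eq_zero_of_zero hs h0]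
  classical
  set p : List ℕ → PMF ℕ := fun w =>
    if hw : ∑' i, c (w ++ [i]) = 0 then PMF.pure 0
    else PMF.normalize (fun i => c (w ++ [i])) hw (tsum_preNaturalMeasure_snoc_ne_top w) with hp
  obtain ⟨μ, hμ, hμw⟩ := exists_isProbabilityMeasure_wordSet_snoc p
  have hmass : ∀ w, μ (wordSet w) * c [] ≤ c w := by
    intro w
    induction w using List.reverseRecOn with
    | nil => simpa using mul_le_mul_left (prob_le_one (μ := μ) (s := wordSet [])) (c [])
    | append_singleton w i ih =>
      rw [hμw]
      by_cases hw : ∑' i, c (w ++ [i]) = 0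
      · have h1 : c w = 0 := le_antisymm ((hsub w).trans hw.le) zero_le
        have h2 : μ (wordSet w) = 0 := by
          have := le_antisymm (ih.trans h1.le) zero_le
          exact (mul_eq_zero.1 this).resolve_right hc0
        simp [h2]
      · have hpw : p w i = c (w ++ [i]) * (∑' i, c (w ++ [i]))⁻¹ := by
          simp only [hp, dif_neg hw, PMF.normalize_apply]
        have hwt : ∑' i, c (w ++ [i]) ≠ ∞ := tsum_preNaturalMeasure_snoc_ne_top w
        calc μ (wordSet w) * p w i * c [] = μ (wordSet w) * c [] * p w i := by ring
          _ ≤ (∑' i, c (w ++ [i])) * (c (w ++ [i]) * (∑' i, c (w ++ [i]))⁻¹) := by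
              rw [hpw]
              gcongr
              exact ih.trans (hsub w)
          _ = c (w ++ [i]) := by
              rw [mul_comm, mul_assoc, ENNReal.inv_mul_cancel hw hwt, mul_one]
  refine ⟨μ, hμ, ?_, (c [])⁻¹, ENNReal.inv_ne_top.2 hc0, fun w => ?_⟩
  · have hcov : (F.paths ω)ᶜ ⊆ ⋃ w ∈ (F.words ω)ᶜ, wordSet w := by
      intro x hx
      simp only [paths, Set.mem_compl_iff, Set.mem_ofPred_eq, not_forall] at hx
      obtain ⟨n, hn⟩ := hx
      exact Set.mem_iUnion₂.2 ⟨initialWord x n, hn, by simp [wordSet]⟩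
    refine measure_mono_null hcov ?_
    rw [measure_biUnion_null_iff (Set.to_countable _)]
    intro w hw
    have h1 : c w = 0 := preNaturalMeasure_cylinder_of_notMem hw
    have := le_antisymm ((hmass w).trans h1.le) zero_le
    exact (mul_eq_zero.1 this).resolve_right hc0
  · rw [mul_comm, ← div_eq_mul_inv, ENNReal.le_div_iff_mul_le (Or.inl hc0) (Or.inl (hctop _))]
    exact (hmass w).trans (hcle w)

end AffineFamily

/-! ### The potential-theoretic lower bound for the dimension -/

theorem le_mul_rpow_of_mul_rpow_neg_le {m d K : ℝ≥0∞} {t : ℝ} (ht : 0 < t) (hd : d ≠ ∞)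
    (hK : K ≠ ∞) (h : m * d ^ (-t) ≤ K) : m ≤ K * d ^ t := by
  -- for `d = 0` the hypothesis reads `m * ∞ ≤ K`
  rcases eq_or_ne d 0 with rfl | hd0
  · rw [ENNReal.zero_rpow_of_neg (by linarith)] at h
    by_cases hm : m = 0
    · simp [hm]
    · rw [ENNReal.mul_top hm] at h
      exact absurd (top_le_iff.1 h) hK
  · rw [ENNReal.rpow_neg, ← div_eq_mul_inv] at h
    rwa [ENNReal.div_le_iff (by simp [ENNReal.rpow_eq_zero_iff, hd0, hd])
      (ENNReal.rpow_ne_top_of_nonneg ht.le hd)] at h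

/-- A set that carries the image of a measure with finite `t`-energy has dimension at least `t`. -/
theorem le_dimH_of_lintegral_rpow_neg_ne_top {Ω E : Type*} [MeasurableSpace Ω]
    [NormedAddCommGroup E] [MeasurableSpace E] [BorelSpace E] [SecondCountableTopology E]
    {μ : Measure Ω} [IsProbabilityMeasure μ] {f : Ω → E} (hf : Measurable f) {A : Set E}
    (hA : ∀ᵐ x ∂μ, f x ∈ A) {t : ℝ≥0} (ht : 0 < t)
    (h : ∫⁻ x, ∫⁻ y, ‖f x - f y‖ₑ ^ (-(t : ℝ)) ∂μ ∂μ ≠ ∞) : (t : ℝ≥0∞) ≤ dimH A := by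
  set G : Ω → ℝ≥0∞ := fun x => ∫⁻ y, ‖f x - f y‖ₑ ^ (-(t : ℝ)) ∂μ with hG
  have hGm : Measurable G := by
    refine Measurable.lintegral_prod_right' (f := fun q : Ω × Ω => ‖f q.1 - f q.2‖ₑ ^ (-(t : ℝ))) ?_
    exact ((hf.comp measurable_fst).sub (hf.comp measurable_snd)).enorm.pow_const _
  obtain ⟨K, hK⟩ : ∃ K : ℕ, μ {x | G x ≤ K} ≠ 0 := by
    by_contra! hcon
    have h1 : ∀ᵐ x ∂μ, ∀ K : ℕ, ¬ G x ≤ K := ae_all_iff.2 fun K => by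
      simpa [ae_iff] using hcon K
    have h2 : ∀ᵐ x ∂μ, False := by
      filter_upwards [h1, ae_lt_top hGm h] with x hx hx'
      obtain ⟨n, hn⟩ := ENNReal.exists_nat_gt hx'.ne
      exact hx n hn.le
    exact IsProbabilityMeasure.ne_zero μ (by simpa using h2)
  set S : Set Ω := {x | G x ≤ K} with hS
  have hSm : MeasurableSet S := measurableSet_le hGm measurable_const
  set ν : Measure E := (μ.restrict S).map f with hν
  -- the measure `ν` has the growth of the `t`-dimensional Hausdorff measure
  have hgrowth : ∀ B : Set E, Metric.ediam B ≤ 1 → ν B ≤ (K + 1) * Metric.ediam B ^ (t : ℝ) := by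
    intro B hB
    have hcl : MeasurableSet (closure B) := isClosed_closure.measurableSet
    refine (measure_mono subset_closure).trans ?_
    rw [hν, Measure.map_apply hf hcl, Measure.restrict_apply (hf hcl)]
    rcases Set.eq_empty_or_nonempty (f ⁻¹' closure B ∩ S) with he | ⟨x, hxB, hxS⟩
    · simp [he]
    refine (measure_mono Set.inter_subset_left).trans ?_
    refine le_mul_rpow_of_mul_rpow_neg_le (by exact_mod_cast ht)
      (ne_top_of_le_ne_top ENNReal.one_ne_top hB) (by simp) ?_
    calc μ (f ⁻¹' closure B) * Metric.ediam B ^ (-(t : ℝ))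
        = ∫⁻ _ in f ⁻¹' closure B, Metric.ediam B ^ (-(t : ℝ)) ∂μ := by
          rw [setLIntegral_const, mul_comm]
      _ ≤ ∫⁻ y in f ⁻¹' closure B, ‖f x - f y‖ₑ ^ (-(t : ℝ)) ∂μ := by
          refine setLIntegral_mono' (hf hcl) fun y hy => ?_
          rw [ENNReal.rpow_neg, ENNReal.rpow_neg, ENNReal.inv_le_inv]
          gcongr
          rw [← edist_eq_enorm_sub, ← Metric.ediam_closure]
          exact Metric.edist_le_ediam_of_mem hxB hy
      _ ≤ G x := setLIntegral_le_lintegral _ _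
      _ ≤ K := hxS
      _ ≤ K + 1 := le_self_add
  have hK0 : ((K : ℝ≥0∞) + 1) ≠ 0 := by simp
  have hKt : ((K : ℝ≥0∞) + 1) ≠ ∞ := by simp
  have hle : ((K : ℝ≥0∞) + 1)⁻¹ • ν ≤ Measure.hausdorffMeasure (t : ℝ) := by
    refine Measure.le_hausdorffMeasure _ _ 1 one_pos fun B hB => ?_
    rw [Measure.smul_apply, smul_eq_mul, mul_comm, ← div_eq_mul_inv,
      ENNReal.div_le_iff hK0 hKt, mul_comm]
    exact hgrowth B hB
  have hνA : ν A ≠ 0 := by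
    have h1 : μ.restrict S (f ⁻¹' A) ≤ ν A := Measure.le_map_apply hf.aemeasurable A
    rw [Measure.restrict_apply' hSm] at h1
    have h2 : μ S ≤ μ (f ⁻¹' A ∩ S) := by
      refine measure_mono_ae ?_
      filter_upwards [hA] with x hx hxS using ⟨hx, hxS⟩
    exact fun h0 => hK (le_antisymm ((h2.trans h1).trans h0.le) zero_le)
  refine le_dimH_of_hausdorffMeasure_ne_zero fun h0 => hνA ?_
  have := hle A
  rw [h0, Measure.smul_apply, smul_eq_mul] at this
  exact (mul_eq_zero.1 (le_antisymm this zero_le)).resolve_left (ENNReal.inv_ne_zero.2 hKt)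

namespace AffineFamily

variable {D : ℕ} {L : Type*} {F : AffineFamily D L} {ω : List ℕ → L} {σ : ℝ} {s : ℝ≥0}

theorem ContractsBy.measurable_enorm_coding_sub (hF : F.ContractsBy σ) (hσ0 : 0 ≤ σ)
    (hσ1 : σ < 1) (ω : List ℕ → L) :
    Measurable fun q : (F.Classes → EuclideanSpace ℝ (Fin D)) × (ℕ → ℕ) × (ℕ → ℕ) =>
      ‖F.coding ω q.2.1 q.1 - F.coding ω q.2.2 q.1‖ₑ := by
  have hc := hF.continuous_coding hσ0 hσ1 ω
  refine Continuous.measurable (Continuous.enorm (Continuous.sub ?_ ?_))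
  · exact (hc.comp (continuous_fst.comp continuous_snd)).clm_apply continuous_fst
  · exact (hc.comp (continuous_snd.comp continuous_snd)).clm_apply continuous_fst

theorem ContractsBy.ofReal_singularValueFunction_le_pow (hF : F.ContractsBy σ) (hσ0 : 0 < σ)
    (hs : (s : ℝ) < D) {w : List ℕ} (hw : w ∈ F.words ω) :
    ENNReal.ofReal (singularValueFunction s (F.wordLin ω w)) ≤
      (ENNReal.ofReal σ ^ (s : ℝ)) ^ w.length := by
  refine (ENNReal.ofReal_le_ofReal (singularValueFunction_le_rpow (wordLin_injective ω w) hs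
    (pow_pos hσ0 _) (hF.norm_wordLin_le hσ0.le hw))).trans_eq ?_
  rw [ENNReal.ofReal_rpow_of_pos hσ0, ← ENNReal.ofReal_pow (by positivity)]
  congr 1
  rw [← Real.rpow_natCast, ← Real.rpow_natCast, ← Real.rpow_mul hσ0.le, ← Real.rpow_mul hσ0.le,
    mul_comm]

/-- The `θ s`-potential of a Frostman measure with exponent `s`, averaged over the parameter, is
bounded: the words `w` of length `n` contribute `μ[w] Φ^s(T_w)^{-θ} ≤ C Φ^s(T_w)^{1 - θ}`, which
decays geometrically in `n`. -/
theorem ContractsBy.exists_lintegral_lintegral_coding_le (hF : F.ContractsBy σ)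
    (hσ0 : 0 < σ) (hσ1 : σ < 1 / 2) (hD : 0 < D) (hs0 : 0 < s) (hs : (s : ℝ) < D)
    {θ : ℝ} (hθ0 : 0 ≤ θ) (hθ : θ < 1) (ρ : ℝ) {μ : Measure (ℕ → ℕ)}
    (hμ0 : μ (F.paths ω)ᶜ = 0) {C : ℝ≥0∞} (hC : C ≠ ∞)
    (hμ : ∀ w, μ (wordSet w) ≤ C * ENNReal.ofReal (singularValueFunction s (F.wordLin ω w))) :
    ∃ Q : ℝ≥0∞, Q ≠ ∞ ∧ ∀ x ∈ F.paths ω,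
      ∫⁻ y, (∫⁻ a in Metric.closedBall (0 : F.Classes → EuclideanSpace ℝ (Fin D)) ρ,
        ‖F.coding ω x a - F.coding ω y a‖ₑ ^ (-(θ * s))) ∂μ ≤ Q := by
  obtain ⟨C', hC', hle⟩ := hF.exists_setLIntegral_coding_sub_rpow_neg_le hσ0.le hσ1 hD hs hθ0 hθ ρ ω
  set Φ : List ℕ → ℝ≥0∞ := fun w => ENNReal.ofReal (singularValueFunction s (F.wordLin ω w)) with hΦ
  have hΦ0 : ∀ w, Φ w ≠ 0 := fun w =>
    (ENNReal.ofReal_pos.2 (singularValueFunction_pos (wordLin_injective ω w) hs)).ne'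
  have hΦt : ∀ w, Φ w ≠ ∞ := fun w => ENNReal.ofReal_ne_top
  set r : ℝ≥0∞ := ENNReal.ofReal σ ^ (s : ℝ) with hr
  have hr1 : r < 1 := ENNReal.rpow_lt_one (by simpa using (by linarith : σ < 1))
    (by exact_mod_cast hs0)
  have hΦr : ∀ x ∈ F.paths ω, ∀ n, Φ (initialWord x n) ≤ r ^ n := fun x hx n => by
    simpa using hF.ofReal_singularValueFunction_le_pow hσ0 hs (hx n)
  have hrθ : r ^ (1 - θ) < 1 := ENNReal.rpow_lt_one hr1 (by linarith)
  refine ⟨C * C' * (1 - r ^ (1 - θ))⁻¹, ENNReal.mul_ne_top (ENNReal.mul_ne_top hC hC')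
    (ENNReal.inv_ne_top.2 (tsub_pos_of_lt hrθ).ne'), fun x hx => ?_⟩
  -- on the diagonal the kernel is infinite
  have hnull : μ {x} = 0 := by
    have h1 : Tendsto (fun n => C * r ^ n) atTop (𝓝 (C * 0)) :=
      ENNReal.Tendsto.const_mul (ENNReal.tendsto_pow_atTop_nhds_zero_of_lt_one hr1) (Or.inr hC)
    rw [mul_zero] at h1
    refine le_antisymm (ge_of_tendsto' h1 fun n => ?_) zero_le
    calc μ {x} ≤ μ (wordSet (initialWord x n)) := measure_mono (by simp [wordSet])
      _ ≤ C * r ^ n := (hμ _).trans (by gcongr; exact hΦr x hx n)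
  have hae : ∀ᵐ y ∂μ, y ∈ F.paths ω ∧ y ≠ x := by
    have h1 : ∀ᵐ y ∂μ, y ∈ F.paths ω := hμ0
    have h2 : ∀ᵐ y ∂μ, y ≠ x := by simpa [ae_iff] using hnull
    filter_upwards [h1, h2] with y hy hy' using ⟨hy, hy'⟩
  calc ∫⁻ y, (∫⁻ a in Metric.closedBall (0 : F.Classes → EuclideanSpace ℝ (Fin D)) ρ,
        ‖F.coding ω x a - F.coding ω y a‖ₑ ^ (-(θ * s))) ∂μ
      ≤ ∫⁻ y, ∑' n, (wordSet (initialWord x n)).indicator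
          (fun _ => C' * Φ (initialWord x n) ^ (-θ)) y ∂μ := by
        refine lintegral_mono_ae ?_
        filter_upwards [hae] with y hy
        have hex : ∃ n, x n ≠ y n := by
          by_contra! hcon
          exact hy.2 (funext hcon).symm
        classical
        have hinit : initialWord x (Nat.find hex) = initialWord y (Nat.find hex) :=
          initialWord_eq_iff.2 fun k hk => not_not.1 (Nat.find_min hex hk)
        refine (hle x hx y hy.1 (Nat.find hex) hinit (Nat.find_spec hex)).trans ?_
        refine le_trans (le_of_eq ?_) (ENNReal.le_tsum (Nat.find hex))
        rw [Set.indicator_of_mem]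
        simp only [wordSet, length_initialWord, Set.mem_ofPred_eq, hinit]
    _ = ∑' n, ∫⁻ y, (wordSet (initialWord x n)).indicator
          (fun _ => C' * Φ (initialWord x n) ^ (-θ)) y ∂μ :=
        lintegral_tsum fun n =>
          (measurable_const.indicator (measurableSet_wordSet _)).aemeasurable
    _ ≤ ∑' n, C * C' * (r ^ (1 - θ)) ^ n := by
        refine ENNReal.tsum_le_tsum fun n => ?_
        rw [lintegral_indicator_const (measurableSet_wordSet _)]
        set w := initialWord x n with hw
        calc C' * Φ w ^ (-θ) * μ (wordSet w) ≤ C' * Φ w ^ (-θ) * (C * Φ w) := by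
              gcongr
              exact hμ w
          _ = C * C' * (Φ w ^ (-θ) * Φ w ^ (1 : ℝ)) := by
              rw [ENNReal.rpow_one]
              ring
          _ = C * C' * Φ w ^ (1 - θ) := by
              rw [← ENNReal.rpow_add _ _ (hΦ0 w) (hΦt w)]
              congr 2
              ring
          _ ≤ C * C' * (r ^ n) ^ (1 - θ) := by
              gcongr
              exact hΦr x hx n
          _ = C * C' * (r ^ (1 - θ)) ^ n := by
              have h1 := ENNReal.rpow_mul r n (1 - θ)
              have h2 := ENNReal.rpow_mul r (1 - θ) n
              rw [ENNReal.rpow_natCast] at h1 h2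
              rw [← h1, ← h2, mul_comm (n : ℝ)]
    _ = C * C' * (1 - r ^ (1 - θ))⁻¹ := by
        rw [ENNReal.tsum_mul_left, ENNReal.tsum_geometric]

/-- Tonelli's theorem turns the bound for the averaged energy into finiteness of the energy for
almost every parameter. -/
theorem ContractsBy.ae_le_dimH_attractor (hF : F.ContractsBy σ)
    (hσ0 : 0 < σ) (hσ1 : σ < 1 / 2) (hD : 0 < D) (hs0 : 0 < s) (hs : (s : ℝ) < D)
    {θ : ℝ≥0} (hθ0 : 0 < θ) (hθ : θ < 1) (h : F.naturalMeasure ω s (F.paths ω) ≠ 0) :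
    ∀ᵐ a : F.Classes → EuclideanSpace ℝ (Fin D),
      ((θ * s : ℝ≥0) : ℝ≥0∞) ≤ dimH (F.attractor a ω) := by
  have hσ1' : σ < 1 := by linarith
  obtain ⟨μ, hμ, hμ0, C, hC, hμC⟩ := exists_frostman_measure hs h
  have hpaths : ∀ᵐ x ∂μ, x ∈ F.paths ω := hμ0
  have hmeas : Measurable fun q : (F.Classes → EuclideanSpace ℝ (Fin D)) × (ℕ → ℕ) × (ℕ → ℕ) =>
      ‖F.coding ω q.2.1 q.1 - F.coding ω q.2.2 q.1‖ₑ ^ (-((θ : ℝ) * s)) :=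
    (hF.measurable_enorm_coding_sub hσ0.le hσ1' ω).pow_const _
  have hball : ∀ ρ : ℕ, ∀ᵐ a : F.Classes → EuclideanSpace ℝ (Fin D),
      a ∈ Metric.closedBall (0 : F.Classes → EuclideanSpace ℝ (Fin D)) ρ →
      ∫⁻ x, ∫⁻ y, ‖F.coding ω x a - F.coding ω y a‖ₑ ^ (-((θ : ℝ) * s)) ∂μ ∂μ < ∞ := by
    intro ρ
    rw [← ae_restrict_iff' Metric.isClosed_closedBall.measurableSet]
    obtain ⟨Q, hQ, hQle⟩ := hF.exists_lintegral_lintegral_coding_le hσ0 hσ1 hD hs0 hs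
      (NNReal.coe_nonneg θ) (by exact_mod_cast hθ) ρ hμ0 hC hμC
    set B := Metric.closedBall (0 : F.Classes → EuclideanSpace ℝ (Fin D)) ρ with hB
    have hm1 : Measurable fun q : ((F.Classes → EuclideanSpace ℝ (Fin D)) × (ℕ → ℕ)) =>
        ∫⁻ y, ‖F.coding ω q.2 q.1 - F.coding ω y q.1‖ₑ ^ (-((θ : ℝ) * s)) ∂μ :=
      Measurable.lintegral_prod_right'
        (f := fun q : ((F.Classes → EuclideanSpace ℝ (Fin D)) × (ℕ → ℕ)) × (ℕ → ℕ) =>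
          ‖F.coding ω q.1.2 q.1.1 - F.coding ω q.2 q.1.1‖ₑ ^ (-((θ : ℝ) * s)))
        (hmeas.comp (f := fun q : ((F.Classes → EuclideanSpace ℝ (Fin D)) × (ℕ → ℕ)) × (ℕ → ℕ) =>
          (q.1.1, q.1.2, q.2)) (by fun_prop))
    refine ae_lt_top (Measurable.lintegral_prod_right' hm1) (ne_top_of_le_ne_top hQ ?_)
    calc ∫⁻ a in B, ∫⁻ x, ∫⁻ y, ‖F.coding ω x a - F.coding ω y a‖ₑ ^ (-((θ : ℝ) * s)) ∂μ ∂μ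
        = ∫⁻ x, (∫⁻ a in B, ∫⁻ y, ‖F.coding ω x a - F.coding ω y a‖ₑ ^ (-((θ : ℝ) * s)) ∂μ) ∂μ :=
          lintegral_lintegral_swap hm1.aemeasurable
      _ = ∫⁻ x, ∫⁻ y, (∫⁻ a in B, ‖F.coding ω x a - F.coding ω y a‖ₑ ^ (-((θ : ℝ) * s))) ∂μ ∂μ := by
          refine lintegral_congr fun x => lintegral_lintegral_swap ?_
          exact (hmeas.comp (f := fun q : (F.Classes → EuclideanSpace ℝ (Fin D)) × (ℕ → ℕ) =>
            (q.1, x, q.2)) (by fun_prop)).aemeasurable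
      _ ≤ ∫⁻ _, Q ∂μ := by
          refine lintegral_mono_ae ?_
          filter_upwards [hpaths] with x hx using hQle x hx
      _ = Q := by simp
  filter_upwards [ae_all_iff.2 hball] with a ha
  obtain ⟨n, hn⟩ := exists_nat_ge ‖a‖
  have hfin := ha n (by simpa using hn)
  have hcm : Measurable fun x => F.coding ω x a :=
    ((hF.continuous_coding hσ0.le hσ1' ω).clm_apply continuous_const).measurable
  refine le_dimH_of_lintegral_rpow_neg_ne_top hcm (μ := μ) ?_ (mul_pos hθ0 hs0) ?_
  · filter_upwards [hpaths] with x hx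
    exact ⟨x, hx, hF.tendsto_wordMap hσ0.le hσ1' hx a⟩
  · simpa using hfin.ne

end AffineFamily

/-! ### The upper bound for the dimension -/

section Covering

variable {D : ℕ} {T : EuclideanSpace ℝ (Fin D) →ₗ[ℝ] EuclideanSpace ℝ (Fin D)}

/-- The number of cubes of side comparable to `σ_m` that are used in the direction of `σ_i` in
order to cover the image of a ball. -/
noncomputable def boxCount (T : EuclideanSpace ℝ (Fin D) →ₗ[ℝ] EuclideanSpace ℝ (Fin D))
    (m : ℕ) (i : Fin D) : ℕ :=
  ⌊T.singularValues i / T.singularValues m⌋₊ + 1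

/-- The image of a ball under `T` is covered by `∏ i, boxCount T m i` sets of diameter comparable
to the `m`-th singular value of `T`. -/
theorem exists_cover_image_closedBall (hT : Function.Injective T) {m : ℕ} (hm : m < D) {R : ℝ}
    (hR : 0 < R) (b : EuclideanSpace ℝ (Fin D)) :
    ∃ t : ((i : Fin D) → Fin (boxCount T m i)) → Set (EuclideanSpace ℝ (Fin D)),
      (∀ z, ‖z‖ ≤ R → b + T z ∈ ⋃ k, t k) ∧
      ∀ k, Metric.ediam (t k) ≤ ENNReal.ofReal (2 * D * R * T.singularValues m) := by
  obtain ⟨v, u, hvu⟩ := exists_singularValueDecomposition hT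
  have hσm : 0 < T.singularValues m := singularValues_pos_of_injective hT ⟨m, hm⟩
  set g : EuclideanSpace ℝ (Fin D) → Fin D → ℝ := fun z i =>
    (⟪u i, z - b⟫ + R * T.singularValues i) / (2 * R * T.singularValues m) with hg
  refine ⟨fun k => {z | ∀ i, 0 ≤ g z i ∧ ⌊g z i⌋₊ = k i}, fun z hz => ?_, fun k => ?_⟩
  · have hcoord : ∀ i, |⟪u i, T z⟫| ≤ R * T.singularValues i := by
      intro i
      rw [inner_eq_singularValues_mul_inner hvu, abs_mul,
        abs_of_nonneg (T.singularValues_nonneg _), mul_comm]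
      refine mul_le_mul_of_nonneg_right ?_ (T.singularValues_nonneg _)
      refine (abs_real_inner_le_norm _ _).trans ?_
      simpa using hz
    have hgz : ∀ i, 0 ≤ g (b + T z) i ∧ g (b + T z) i ≤ T.singularValues i / T.singularValues m := by
      intro i
      have h1 := abs_le.1 (hcoord i)
      simp only [hg, add_sub_cancel_left]
      constructor
      · exact div_nonneg (by linarith) (by positivity)
      · rw [div_le_div_iff₀ (by positivity) hσm]
        have h2 : ⟪u i, T z⟫ + R * T.singularValues i ≤ 2 * R * T.singularValues i := by linarith
        calc (⟪u i, T z⟫ + R * T.singularValues i) * T.singularValues m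
            ≤ (2 * R * T.singularValues i) * T.singularValues m := by gcongr
          _ = T.singularValues i * (2 * R * T.singularValues m) := by ring
    refine Set.mem_iUnion.2 ⟨fun i => ⟨⌊g (b + T z) i⌋₊,
      Nat.lt_succ_of_le (Nat.floor_le_floor (hgz i).2)⟩, fun i => ⟨(hgz i).1, rfl⟩⟩
  · refine Metric.ediam_le fun z hz z' hz' => ?_
    rw [edist_dist]
    refine ENNReal.ofReal_le_ofReal ?_
    have hcoord : ∀ i, ‖⟪u i, z - z'⟫‖ ≤ 2 * R * T.singularValues m := by
      intro i
      have h1 := Nat.floor_le (hz i).1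
      have h2 := Nat.lt_floor_add_one (g z i)
      have h3 := Nat.floor_le (hz' i).1
      have h4 := Nat.lt_floor_add_one (g z' i)
      rw [(hz i).2] at h1 h2
      rw [(hz' i).2] at h3 h4
      have h5 : |g z i - g z' i| ≤ 1 := by
        rw [abs_le]
        constructor <;> linarith
      have h6 : ⟪u i, z - z'⟫ = (g z i - g z' i) * (2 * R * T.singularValues m) := by
        simp only [hg, inner_sub_right]
        field_simp
        ring
      rw [h6, Real.norm_eq_abs, abs_mul, abs_of_pos (by positivity : 0 < 2 * R * T.singularValues m)]
      exact mul_le_of_le_one_left (by positivity) h5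
    rw [dist_eq_norm, ← u.sum_repr (z - z')]
    refine (norm_sum_le _ _).trans ?_
    calc ∑ i, ‖u.repr (z - z') i • u i‖ ≤ ∑ _i : Fin D, 2 * R * T.singularValues m := by
          refine Finset.sum_le_sum fun i _ => ?_
          rw [norm_smul, u.repr_apply_apply, u.norm_eq_one, mul_one]
          exact hcoord i
      _ = 2 * D * R * T.singularValues m := by
          simp
          ring

/-- The sum of the `s`-th powers of the diameters in the covering of
`exists_cover_image_closedBall` with `m = ⌊s⌋` is comparable to `Φ^s(T)`. -/
theorem prod_boxCount_mul_rpow_le (hT : Function.Injective T) {s : ℝ≥0} (hs : (s : ℝ) < D) :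
    ((∏ i, boxCount T ⌊s⌋₊ i : ℕ) : ℝ) * T.singularValues ⌊s⌋₊ ^ (s : ℝ) ≤
      2 ^ D * singularValueFunction s T := by
  have hm : ⌊s⌋₊ < D := floor_lt_of_coe_lt hs
  set m := ⌊s⌋₊ with hmdef
  have hσm : 0 < T.singularValues m := singularValues_pos_of_injective hT ⟨m, hm⟩
  -- `⌊q⌋ + 1 ≤ 2 max (1, q)` for each of the quotients `q = σ_i / σ_m`
  have hN : ∀ i : Fin D, (boxCount T m i : ℝ) ≤ 2 * (if (i : ℕ) < m then
      T.singularValues i / T.singularValues m else if (i : ℕ) = m then 1 else 1) := by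
    intro i
    have h1 : (⌊T.singularValues i / T.singularValues m⌋₊ : ℝ) ≤
        T.singularValues i / T.singularValues m :=
      Nat.floor_le (div_nonneg (T.singularValues_nonneg _) hσm.le)
    rw [boxCount, Nat.cast_add, Nat.cast_one, ite_self]
    split_ifs with hi
    · have : 1 ≤ T.singularValues i / T.singularValues m := by
        rw [one_le_div hσm]
        exact T.singularValues_antitone hi.le
      linarith
    · have : T.singularValues i / T.singularValues m ≤ 1 := by
        rw [div_le_one hσm]
        exact T.singularValues_antitone (not_lt.1 hi)
      linarith
  have hprod : ((∏ i, boxCount T m i : ℕ) : ℝ) ≤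
      2 ^ D * ∏ i ∈ Finset.range m, (T.singularValues i / T.singularValues m) := by
    rw [Nat.cast_prod]
    refine (Finset.prod_le_prod (fun i _ => Nat.cast_nonneg _) fun i _ => hN i).trans_eq ?_
    rw [Finset.prod_mul_distrib, prod_fin_ite_floor hm
      (fun i => T.singularValues i / T.singularValues m) (fun _ => 1)]
    simp
  calc ((∏ i, boxCount T m i : ℕ) : ℝ) * T.singularValues m ^ (s : ℝ)
      ≤ (2 ^ D * ∏ i ∈ Finset.range m, (T.singularValues i / T.singularValues m)) *
          T.singularValues m ^ (s : ℝ) := by gcongr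
    _ = 2 ^ D * singularValueFunction s T := by
        rw [singularValueFunction, if_pos hs, ← hmdef, Finset.prod_div_distrib, Finset.prod_const,
          Finset.card_range, Real.rpow_sub hσm, Real.rpow_natCast]
        ring

end Covering

namespace AffineFamily

variable {D : ℕ} {L : Type*} {F : AffineFamily D L} {ω : List ℕ → L} {σ : ℝ} {s : ℝ≥0}

/-- Vanishing of the natural measure bounds the dimension of the attractor for every parameter. -/
theorem ContractsBy.dimH_attractor_le (hF : F.ContractsBy σ) (hσ0 : 0 < σ) (hσ1 : σ < 1)
    (hs : (s : ℝ) < D) (h : F.naturalMeasure ω s (F.paths ω) = 0)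
    (a : F.Classes → EuclideanSpace ℝ (Fin D)) : dimH (F.attractor a ω) ≤ s := by
  have hpre : ∀ j, F.preNaturalMeasure ω s j (F.paths ω) = 0 := by
    simpa [naturalMeasure] using h
  have hm : ⌊s⌋₊ < D := floor_lt_of_coe_lt hs
  set m := ⌊s⌋₊ with hmdef
  have hlt : ∀ j : ℕ, F.preNaturalMeasure ω s j (F.paths ω) < ((j : ℝ≥0∞) + 1)⁻¹ := fun j => by
    rw [hpre]
    exact ENNReal.inv_pos.2 (by simp)
  choose J hJw hJl hJc hJs using fun j => exists_cover_of_preNaturalMeasure_lt (hlt j)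
  set R : ℝ := (1 - σ)⁻¹ * ‖a‖ + 1 with hR
  have hσ1' : 0 < 1 - σ := by linarith
  have hR0 : 0 < R := by positivity
  choose t htc htd using fun w : List ℕ => exists_cover_image_closedBall
    (wordLin_injective (F := F) ω w) hm hR0 (F.wordMap a ω w 0)
  have hzero : Measure.hausdorffMeasure (s : ℝ) (F.attractor a ω) = 0 := by
    set c : ℝ := 2 * D * R with hc
    have hc0 : 0 ≤ c := by positivity
    -- the contribution of the boxes belonging to one word
    have hsum : ∀ w : List ℕ, ∑' k, Metric.ediam (t w k) ^ (s : ℝ) ≤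
        ENNReal.ofReal (c ^ (s : ℝ) * 2 ^ D) *
          ENNReal.ofReal (singularValueFunction s (F.wordLin ω w)) := by
      intro w
      set T := F.wordLin ω w with hT
      have hTi : Function.Injective T := wordLin_injective ω w
      have hσm : 0 ≤ T.singularValues m := T.singularValues_nonneg _
      calc ∑' k, Metric.ediam (t w k) ^ (s : ℝ)
          ≤ ∑' _k : ((i : Fin D) → Fin (boxCount T m i)),
            ENNReal.ofReal ((c * T.singularValues m) ^ (s : ℝ)) := by
            refine ENNReal.tsum_le_tsum fun k => ?_
            rw [← ENNReal.ofReal_rpow_of_nonneg (by positivity) (NNReal.coe_nonneg s)]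
            exact ENNReal.rpow_le_rpow (htd w k) (NNReal.coe_nonneg s)
        _ = ENNReal.ofReal (((∏ i, boxCount T m i : ℕ) : ℝ) *
              (c * T.singularValues m) ^ (s : ℝ)) := by
            rw [tsum_fintype, Finset.sum_const, Finset.card_univ, Fintype.card_pi, nsmul_eq_mul,
              ENNReal.ofReal_mul (Nat.cast_nonneg _), ENNReal.ofReal_natCast]
            simp
        _ ≤ ENNReal.ofReal (c ^ (s : ℝ) * 2 ^ D * singularValueFunction s T) := by
            refine ENNReal.ofReal_le_ofReal ?_
            rw [Real.mul_rpow hc0 hσm]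
            calc ((∏ i, boxCount T m i : ℕ) : ℝ) * (c ^ (s : ℝ) * T.singularValues m ^ (s : ℝ))
                = c ^ (s : ℝ) * (((∏ i, boxCount T m i : ℕ) : ℝ) *
                    T.singularValues m ^ (s : ℝ)) := by ring
              _ ≤ c ^ (s : ℝ) * (2 ^ D * singularValueFunction s T) := by
                  exact mul_le_mul_of_nonneg_left (prod_boxCount_mul_rpow_le hTi hs) (by positivity)
              _ = _ := by ring
        _ = _ := ENNReal.ofReal_mul (by positivity)
    have hliminf := Measure.hausdorffMeasure_le_liminf_tsum (β := ℕ)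
      (ι := fun j => Σ w : J j, ((i : Fin D) → Fin (boxCount (F.wordLin ω w) m i)))
      (s : ℝ) (F.attractor a ω) (l := atTop) (fun j => ENNReal.ofReal (c * σ ^ j))
      ?_ (fun j q => t q.1 q.2) (Eventually.of_forall fun j q => ?_)
      (Eventually.of_forall fun j => ?_)
    · refine le_antisymm (hliminf.trans ?_) zero_le
      have hlim : Tendsto (fun j : ℕ => ENNReal.ofReal (c ^ (s : ℝ) * 2 ^ D) *
          ((j : ℝ≥0∞) + 1)⁻¹) atTop (𝓝 (ENNReal.ofReal (c ^ (s : ℝ) * 2 ^ D) * 0)) := by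
        refine ENNReal.Tendsto.const_mul ?_ (Or.inr ENNReal.ofReal_ne_top)
        have := (tendsto_add_atTop_iff_nat 1).2 ENNReal.tendsto_inv_nat_nhds_zero
        simpa using this
      rw [mul_zero] at hlim
      rw [← hlim.liminf_eq]
      refine liminf_le_liminf (Eventually.of_forall fun j => ?_)
      calc ∑' q : (Σ w : J j, ((i : Fin D) → Fin (boxCount (F.wordLin ω w) m i))),
            Metric.ediam (t q.1 q.2) ^ (s : ℝ)
          = ∑' w : J j, ∑' k, Metric.ediam (t w k) ^ (s : ℝ) := ENNReal.tsum_sigma' _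
        _ ≤ ∑' w : J j, ENNReal.ofReal (c ^ (s : ℝ) * 2 ^ D) *
              ENNReal.ofReal (singularValueFunction s (F.wordLin ω w)) :=
            ENNReal.tsum_le_tsum fun w => hsum w
        _ = ENNReal.ofReal (c ^ (s : ℝ) * 2 ^ D) *
              ∑' w : J j, ENNReal.ofReal (singularValueFunction s (F.wordLin ω w)) :=
            ENNReal.tsum_mul_left
        _ ≤ _ := by
            gcongr
            exact (hJs j).le
    · have : Tendsto (fun j : ℕ => c * σ ^ j) atTop (𝓝 (c * 0)) :=
        (tendsto_pow_atTop_nhds_zero_of_lt_one hσ0.le hσ1).const_mul c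
      simpa using ENNReal.tendsto_ofReal this
    · obtain ⟨⟨w, hw⟩, k⟩ := q
      refine (htd w k).trans (ENNReal.ofReal_le_ofReal ?_)
      have h1 := singularValues_le_of_norm_map_le (wordLin_injective (F := F) ω w)
        (by positivity) (hF.norm_wordLin_le hσ0.le (hJw j hw)) m
      calc c * (F.wordLin ω w).singularValues m ≤ c * σ ^ w.length := by gcongr
        _ ≤ c * σ ^ j := by
            gcongr c * ?_
            exact pow_le_pow_of_le_one hσ0.le hσ1.le (hJl j w hw)
    · rw [hF.attractor_eq_image hσ0.le hσ1]
      rintro _ ⟨x, hx, rfl⟩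
      obtain ⟨w, hw, hxw⟩ := Set.mem_iUnion₂.1 (hJc j hx)
      have h1 := (hF.coding_eq_add_wordLin hσ0.le hσ1 hx w.length a).2
      rw [hxw.2] at h1
      obtain ⟨k, hk⟩ := Set.mem_iUnion.1 (htc w (F.coding (fun v => ω (w ++ v))
        (fun k => x (w.length + k)) a) (by
          refine (ContinuousLinearMap.le_opNorm _ _).trans ?_
          have := hF.norm_coding_le hσ0.le hσ1 (fun v => ω (w ++ v)) (fun k => x (w.length + k))
          have h2 : ‖F.coding (fun v => ω (w ++ v)) (fun k => x (w.length + k))‖ * ‖a‖ ≤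
            (1 - σ)⁻¹ * ‖a‖ := by gcongr
          linarith))
      refine Set.mem_iUnion.2 ⟨⟨⟨w, hw⟩, k⟩, ?_⟩
      change F.coding ω x a ∈ t w k
      rw [h1]
      exact hk
  exact dimH_le_of_hausdorffMeasure_ne_top (by rw [hzero]; exact ENNReal.zero_ne_top)

end AffineFamily

/-! ### The dimension for almost every parameter -/

theorem theorem3p2 {D : ℕ} (hD : 0 < D) {L : Type*} (F : AffineFamily D L)
    (σ : ℝ) (hσ : σ < 1 / 2)
    (hF : ∀ (l : L) (i : Fin (F.card l)) (k : ℕ), (F.lin l i).singularValues k ≤ σ)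
    (ω : List ℕ → L) :
    ∀ᵐ a ∂(volume : Measure (F.Classes → EuclideanSpace ℝ (Fin D))),
      dimH (F.attractor a ω) = min (D : ℝ≥0∞) (F.affinityDim ω) := by
  -- the singular values of a non-singular map are positive
  have hσ0 : 0 < σ := lt_of_lt_of_le
    (singularValues_pos_of_injective (AffineFamily.lin_injective (F := F) (ω [])
      ⟨0, F.card_pos _⟩) ⟨0, hD⟩) (hF _ _ 0)
  have hFσ : F.ContractsBy σ := fun l i =>
    norm_map_le_of_singularValues_le (AffineFamily.lin_injective l i) hσ0.le (hF l i)
  have hupper : ∀ a, dimH (F.attractor a ω) ≤ min (D : ℝ≥0∞) (F.affinityDim ω) := by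
    intro a
    have hDle : dimH (F.attractor a ω) ≤ (D : ℝ≥0∞) := by
      refine (dimH_mono (Set.subset_univ _)).trans_eq ?_
      rw [Real.dimH_univ_eq_finrank]
      simp
    refine le_min hDle (le_iInf₂ fun s hs => ?_)
    rcases lt_or_ge (s : ℝ) D with h | h
    · exact hFσ.dimH_attractor_le hσ0 (by linarith) h hs a
    · refine hDle.trans ?_
      have : (D : ℝ≥0) ≤ s := by exact_mod_cast h
      exact_mod_cast this
  -- the exceptional null set may depend on the dimension that is compared, so only countably
  -- many are used
  have hlower : ∀ q : ℚ, ∀ᵐ a ∂(volume : Measure (F.Classes → EuclideanSpace ℝ (Fin D))),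
      (Real.toNNReal q : ℝ≥0∞) < min (D : ℝ≥0∞) (F.affinityDim ω) →
        (Real.toNNReal q : ℝ≥0∞) ≤ dimH (F.attractor a ω) := by
    intro q
    set t := Real.toNNReal q with ht
    rcases eq_or_ne t 0 with h0 | h0
    · simp [h0]
    by_cases hlt : (t : ℝ≥0∞) < min (D : ℝ≥0∞) (F.affinityDim ω)
    · obtain ⟨s, hts, hs⟩ := ENNReal.lt_iff_exists_nnreal_btwn.1 hlt
      have hts' : t < s := by exact_mod_cast hts
      have hs0 : 0 < s := lt_of_le_of_lt zero_le hts'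
      have hsD : (s : ℝ) < D := by
        have := hs.trans_le (min_le_left _ _)
        exact_mod_cast this
      have hnat : F.naturalMeasure ω s (F.paths ω) ≠ 0 := fun h =>
        absurd (hs.trans_le (min_le_right _ _)) (not_lt.2 (iInf₂_le s h))
      have hθ : t / s < 1 := by
        rw [div_lt_one hs0]
        exact hts'
      have hmul : t / s * s = t := div_mul_cancel₀ t hs0.ne'
      have := hFσ.ae_le_dimH_attractor hσ0 hσ hD hs0 hsD
        (div_pos (pos_iff_ne_zero.2 h0) hs0) hθ hnat
      rw [hmul] at this
      filter_upwards [this] with a ha _ using ha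
    · exact Eventually.of_forall fun a h => absurd h hlt
  filter_upwards [ae_all_iff.2 hlower] with a ha
  refine le_antisymm (hupper a) (le_of_forall_lt fun c hc => ?_)
  obtain ⟨q, -, hcq, hq⟩ := ENNReal.lt_iff_exists_rat_btwn.1 hc
  exact hcq.trans_le (ha q hq)
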